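/- Let $\mathbb{D}$ be the open unit disk, $\mathbb{S}^1$ the unit circle with arc length $|d\xi|$, and $\delta(z)=1-|z|$. For $p>1$, $\alpha,\lambda\in\mathbb{R}$ and $h:\mathbb{D}\to\mathbb{C}$ differentiable, put $$I_1(p,\alpha,\lambda,h)=\int_{\mathbb{D}}|Dh(z)|^p\,\delta(z)^{\alpha}\log^{\lambda}\!\big(2\delta(z)^{-1}\big)\,dz,\qquad I_2(p,\alpha,\lambda,h)=\int_{\mathbb{D}}|Dh(z)|^p\log^{\lambda}\!\big(e+|Dh(z)|\big)\,\delta(z)^{\alpha}\,dz,$$ where $|Dh(z)|$ is the operator norm of the real differential of $h$ at $z$. For a homeomorphism $\varphi:\mathbb{S}^1\to\mathbb{S}^1$ put $$\mathcal{A}_{p,\alpha,\lambda}(t)=\int_1^t -x^{1+\alpha-p}\log_2^{\lambda}(x^{-1})\,dx\quad(t\ge 0),\qquad \mathcal{V}(p,\alpha,\lambda,\varphi)=\int_{\mathbb{S}^1}\Big(\int_{\mathbb{S}^1}\mathcal{A}_{p,\alpha,\lambda}\big(|\varphi^{-1}(\xi)-\varphi^{-1}(\eta)|\big)\,|d\eta|\Big)_+^{p-1}|d\xi|,$$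 where $x_+=\max(x,0)$ (for $\alpha=p-2$, $\lambda=0$ one has $\mathcal{A}_{p,\alpha,\lambda}(t)=\log(1/t)$, so the inner integral is a well-defined element of $(-\infty,+\infty]$), and let $$P[\varphi](z)=\frac1{2\pi}\int_0^{2\pi}\frac{1-|z|^2}{|e^{i\theta}-z|^2}\,\varphi(e^{i\theta})\,d\theta,\qquad z\in\mathbb{D},$$ be the harmonic (Poisson) extension of $\varphi$. Let $p\in(2,+\infty)$. There is a homeomorphism $\varphi:\mathbb{S}^1\to\mathbb{S}^1$ such that $$\mathcal{V}(p,p-2,0,\varphi)=\infty,\qquad I_1(p,p-2,0,P[\varphi])<\infty,\qquad I_2(p,p-2,0,P[\varphi])<\infty.$$ Consequently $\mathcal{V}$ is dominated by neither $I_1$ nor $I_2$: for $i=1$ and for $i=2$ there is no finite constant $C$ such that $\mathcal{V}(p,p-2,0,\varphi)\le C\,\big(1+I_i(p,p-2,0,P[\varphi])\big)$ for all homeomorphisms $\varphi:\mathbb{S}^1\to\mathbb{S}^1$ (in particular, none such that $\mathcal{V}\le C\,I_i$). -/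

import Mathlib

open MeasureTheory Set
open scoped ENNReal

noncomputable section

namespace CircleExtension

/-- The integral `∫ f⁺ dμ - ∫ f⁻ dμ` of an extended-real-valued function, as an extended real. -/
def extIntegral {X : Type*} [MeasurableSpace X] (μ : Measure X) (f : X → EReal) : EReal :=
  ((∫⁻ x, (f x).toENNReal ∂μ : ℝ≥0∞) : EReal) - ((∫⁻ x, (-f x).toENNReal ∂μ : ℝ≥0∞) : EReal)

/-- Lebesgue measure on the parameter interval `(0, 2π]` of the unit circle; under
`θ ↦ Circle.exp θ = e^{iθ}` it corresponds to arc length. -/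
def angleMeasure : Measure ℝ := volume.restrict (Ioc 0 (2 * Real.pi))

/-- The Poisson integral
`P[φ](z) = (1 / 2π) ∫_0^{2π} (1 - |z|²) / |e^{iθ} - z|² φ(e^{iθ}) dθ`, which on the open unit disk
is the harmonic extension of `φ`. -/
def poissonExtension (φ : Circle ≃ₜ Circle) (z : ℂ) : ℂ :=
  ((2 * Real.pi)⁻¹ : ℝ) •
    ∫ θ, poissonKernel 0 z (Circle.exp θ : ℂ) • (φ (Circle.exp θ) : ℂ) ∂angleMeasure

/-- `I₁(p, α, λ, h) = ∫_𝔻 |Dh|^p δ^α log^λ(2/δ) dz` with `δ(z) = 1 - |z|`; here `|Dh|` is the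
operator norm of the real differential. -/
def energyOne (p α lam : ℝ) (h : ℂ → ℂ) : ℝ≥0∞ :=
  ∫⁻ z in Metric.ball (0 : ℂ) 1, ENNReal.ofReal
    (‖fderiv ℝ h z‖ ^ p * (1 - ‖z‖) ^ α * Real.log (2 * (1 - ‖z‖)⁻¹) ^ lam)

/-- `I₂(p, α, λ, h) = ∫_𝔻 |Dh|^p log^λ(e + |Dh|) δ^α dz` with `δ(z) = 1 - |z|`. -/
def energyTwo (p α lam : ℝ) (h : ℂ → ℂ) : ℝ≥0∞ :=
  ∫⁻ z in Metric.ball (0 : ℂ) 1, ENNReal.ofReal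
    (‖fderiv ℝ h z‖ ^ p * Real.log (Real.exp 1 + ‖fderiv ℝ h z‖) ^ lam * (1 - ‖z‖) ^ α)

/-- `𝒜_{p,α,λ}(t) = ∫_1^t -x^{1+α-p} log₂^λ(1/x) dx = ∫_t^1 x^{1+α-p} log₂^λ(1/x) dx`, an oriented
integral: it is the integral over `(t, 1]` minus the integral over `(1, t]` (one of which is over
the empty set). It is extended-real-valued, so that for instance `𝒜(0) = ∞` when the integral
diverges at the origin. For `λ = 0` and `α = p - 2` it is `log (1/t)`, which is negative for
`t > 1`. -/
def logKernel (p α lam t : ℝ) : EReal :=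
  extIntegral (volume.restrict (Ioc t 1))
      (fun x : ℝ => ((x ^ (1 + α - p) * Real.logb 2 x⁻¹ ^ lam : ℝ) : EReal)) -
    extIntegral (volume.restrict (Ioc 1 t))
      (fun x : ℝ => ((x ^ (1 + α - p) * Real.logb 2 x⁻¹ ^ lam : ℝ) : EReal))

/-- The inner integral `∫_{𝕊¹} 𝒜_{p,α,λ}(|φ⁻¹(ξ) - φ⁻¹(η)|) |dη|`. -/
def innerPotential (p α lam : ℝ) (φ : Circle ≃ₜ Circle) (ξ : Circle) : EReal :=
  extIntegral angleMeasure
    (fun t => logKernel p α lam ‖(φ.symm ξ : ℂ) - (φ.symm (Circle.exp t) : ℂ)‖)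

/-- `𝒱(p, α, λ, φ) = ∫_{𝕊¹} (∫_{𝕊¹} 𝒜_{p,α,λ}(|φ⁻¹(ξ) - φ⁻¹(η)|) |dη|)^{p-1} |dξ|`.
The inner integral may be negative (chords longer than `1` contribute negatively), where the real
power `p - 1` has no meaning; there the outer integrand is taken to be `0`. -/
def inverseEnergy (p α lam : ℝ) (φ : Circle ≃ₜ Circle) : ℝ≥0∞ :=
  ∫⁻ s, (innerPotential p α lam φ (Circle.exp s)).toENNReal ^ (p - 1) ∂angleMeasure

end CircleExtension

end

/-!
For `λ = 0` and `α = p - 2` both energies equal `∫ |D P[φ]|^p δ^(p-2)`, while the inner integral of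
`𝒱` is the logarithmic potential of the measure `dg`, where `g : ℝ → ℝ` is the lift of `φ`, that is
`φ (e^{ix}) = e^{i g(x)}`. So a monotone lift is sought whose `dg`-potential is large in the mean
although the energy is finite.

*Energy.* Writing the Poisson kernel as the real part of the Herglotz kernel gives
`|D P[φ](r e^{iθ})| ≤ C ∫ |g(θ + t) - g(θ)| (δ + |t|)⁻² dt` (`enorm_fderiv_poissonExtension_lift_le`).
Hölder's inequality and Tonelli's theorem bound the energy by `∬ |g(θ + t) - g(θ)|^p t⁻² dθ dt`.
If `Ω` is a modulus of continuity of `g`, then, since `∫ |g(θ + t) - g(θ)| dθ = 2π|t|`, this is at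
most `C ∫ Ω(t)^(p-1) dt / t` (`lintegral_fderiv_poissonExtension_lt_top`).

*Potential.* If `dg` puts mass `l` on each of `m` intervals of length at most `η`, then the potential
is at least `l log (1/η) - 2π` on these intervals, whose total mass is `m l` (`le_inverseEnergy`).

*Construction.* The comb with `m` teeth puts mass `2π/m` on each of `m` equally spaced intervals of
length `η`. Apart from the Lipschitz part `t`, its modulus of continuity is `(2π/m) min(1, t/η)`, and
the `(p-1)`-th power of that has `dt / t`-integral comparable to `m^(-(p-1)) log (1/η)`; the potential
on the teeth is comparable to `m⁻¹ log (1/η)`. As `p - 1 > 1`, the choice `log (1/η) = m^r` with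
`1 < r < p - 1` and `m` large makes the first quantity as small and the second as large as desired.
A geometrically weighted series of such combs, averaged with the identity to be strictly increasing,
has finite energy, and its `k`-th comb alone makes `𝒱` at least `k`.
-/

namespace CircleExtension

/-! ### The gradient of a Poisson integral -/

/-- The Poisson kernel is the real part of `(ζ + z) / (ζ - z)`, and two values of the latter differ
by exactly `2ζ(w - z) / ((ζ - w)(ζ - z))`. -/
theorem abs_poissonKernel_sub_le {z w ζ : ℂ} (hζ : ‖ζ‖ = 1) (hz : ‖z‖ < 1)
    (hw : ‖w - z‖ ≤ (1 - ‖z‖) / 2) :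
    |poissonKernel 0 w ζ - poissonKernel 0 z ζ| ≤ 4 * ‖w - z‖ / ‖ζ - z‖ ^ 2 := by
  have h1 : 1 - ‖z‖ ≤ ‖ζ - z‖ := by
    have := norm_sub_norm_le ζ z
    rwa [hζ] at this
  have hpos : 0 < ‖ζ - z‖ := by linarith
  have h2 : ‖ζ - z‖ / 2 ≤ ‖ζ - w‖ := by
    have h3 : ‖ζ - z‖ ≤ ‖ζ - w‖ + ‖w - z‖ := norm_sub_le_norm_sub_add_norm_sub ζ w z
    linarith
  have hzne : ζ - z ≠ 0 := norm_pos_iff.1 hpos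
  have hwne : ζ - w ≠ 0 := norm_pos_iff.1 (by linarith)
  rw [poissonKernel_eq_re_herglotzRieszKernel, poissonKernel_eq_re_herglotzRieszKernel]
  simp only [Function.comp_apply, herglotzRieszKernel_def, sub_zero]
  rw [← Complex.sub_re]
  have h4 : (ζ + w) / (ζ - w) - (ζ + z) / (ζ - z) = 2 * ζ * (w - z) / ((ζ - w) * (ζ - z)) := by
    field_simp
    ring
  refine (Complex.abs_re_le_norm _).trans ?_
  rw [h4, norm_div, norm_mul, norm_mul, norm_mul, hζ, Complex.norm_ofNat]
  rw [div_le_div_iff₀ (by positivity) (by positivity)]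
  have h5 : ‖ζ - z‖ ^ 2 ≤ 2 * (‖ζ - w‖ * ‖ζ - z‖) := by nlinarith
  nlinarith [mul_le_mul_of_nonneg_left h5 (norm_nonneg (w - z))]

theorem norm_circleExp_sub_sq_ne_zero {z : ℂ} (hz : ‖z‖ < 1) (θ : ℝ) :
    ‖(Circle.exp θ : ℂ) - z‖ ^ 2 ≠ 0 := by
  have := norm_sub_norm_le (Circle.exp θ : ℂ) z
  rw [Circle.norm_coe] at this
  have : 0 < ‖(Circle.exp θ : ℂ) - z‖ := by linarith
  positivity

theorem continuous_poissonKernel_circleExp {z : ℂ} (hz : ‖z‖ < 1) :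
    Continuous fun θ : ℝ => poissonKernel 0 z (Circle.exp θ : ℂ) := by
  simp only [poissonKernel_def, sub_zero]
  refine Continuous.div (by fun_prop) (by fun_prop) (norm_circleExp_sub_sq_ne_zero hz)

instance : IsFiniteMeasure angleMeasure := by unfold angleMeasure; infer_instance

theorem integrable_angleMeasure {E : Type*} [NormedAddCommGroup E] {f : ℝ → E}
    (hf : Continuous f) : Integrable f angleMeasure :=
  hf.integrableOn_Ioc

theorem integral_poissonKernel_circleExp {z : ℂ} (hz : ‖z‖ < 1) :
    ∫ θ, poissonKernel 0 z (Circle.exp θ : ℂ) ∂angleMeasure = 2 * Real.pi := by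
  have h := DiffContOnCl.circleAverage_poissonKernel_smul (f := fun _ => (1 : ℂ)) (c := 0) (R := 1)
    (w := z) diffContOnCl_const (by simpa using hz)
  have h2 : Real.circleAverage (poissonKernel 0 z • fun _ => (1 : ℂ)) 0 1 =
      ((((2 * Real.pi)⁻¹ * ∫ θ, poissonKernel 0 z (Circle.exp θ : ℂ) ∂angleMeasure) : ℝ) : ℂ) := by
    rw [Real.circleAverage, intervalIntegral.integral_of_le (by positivity), Complex.ofReal_mul,
      ← integral_complex_ofReal, angleMeasure, Complex.real_smul]
    simp [circleMap, Circle.coe_exp]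
  rw [h2] at h
  have h3 := Complex.ofReal_injective (h.trans Complex.ofReal_one.symm)
  field_simp at h3
  linarith

/-- Since the kernel has total mass `2π` at both `z` and `w`, an arbitrary constant `c` may be
subtracted from `φ`. -/
theorem norm_poissonExtension_sub_le (φ : Circle ≃ₜ Circle) {z w : ℂ} (hz : ‖z‖ < 1)
    (hw : ‖w - z‖ ≤ (1 - ‖z‖) / 2) (c : ℂ) :
    ‖poissonExtension φ w - poissonExtension φ z‖ ≤
      (2 / Real.pi * ∫ θ, ‖(φ (Circle.exp θ) : ℂ) - c‖ / ‖(Circle.exp θ : ℂ) - z‖ ^ 2 ∂angleMeasure)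
        * ‖w - z‖ := by
  have hw1 : ‖w‖ < 1 := by
    have := norm_sub_norm_le w z
    linarith
  have hφ : Continuous fun θ : ℝ => (φ (Circle.exp θ) : ℂ) := by fun_prop
  have hPw := continuous_poissonKernel_circleExp hw1
  have hPz := continuous_poissonKernel_circleExp hz
  have hne := norm_circleExp_sub_sq_ne_zero hz
  have key : poissonExtension φ w - poissonExtension φ z = ((2 * Real.pi)⁻¹ : ℝ) •
      ∫ θ, (poissonKernel 0 w (Circle.exp θ : ℂ) - poissonKernel 0 z (Circle.exp θ : ℂ)) •
        ((φ (Circle.exp θ) : ℂ) - c) ∂angleMeasure := by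
    have hc : ∫ θ, (poissonKernel 0 w (Circle.exp θ : ℂ) - poissonKernel 0 z (Circle.exp θ : ℂ)) • c
        ∂angleMeasure = 0 := by
      rw [integral_smul_const, integral_sub (integrable_angleMeasure hPw)
        (integrable_angleMeasure hPz), integral_poissonKernel_circleExp hw1,
        integral_poissonKernel_circleExp hz, sub_self, zero_smul]
    simp only [smul_sub]
    rw [integral_sub (integrable_angleMeasure (by fun_prop)) (integrable_angleMeasure (by fun_prop)),
      hc, sub_zero]
    simp only [sub_smul]
    rw [integral_sub (integrable_angleMeasure (by fun_prop)) (integrable_angleMeasure (by fun_prop)),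
      smul_sub]
    rfl
  rw [key, norm_smul, Real.norm_of_nonneg (by positivity)]
  have hb : ‖∫ θ, (poissonKernel 0 w (Circle.exp θ : ℂ) - poissonKernel 0 z (Circle.exp θ : ℂ)) •
        ((φ (Circle.exp θ) : ℂ) - c) ∂angleMeasure‖ ≤ ∫ θ, (4 * ‖w - z‖) *
        (‖(φ (Circle.exp θ) : ℂ) - c‖ / ‖(Circle.exp θ : ℂ) - z‖ ^ 2) ∂angleMeasure := by
    refine norm_integral_le_of_norm_le (integrable_angleMeasure ?_) (ae_of_all _ fun θ => ?_)
    · exact continuous_const.mul (Continuous.div (by fun_prop) (by fun_prop) hne)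
    · rw [norm_smul, Real.norm_eq_abs]
      refine (mul_le_mul_of_nonneg_right
        (abs_poissonKernel_sub_le (Circle.norm_coe _) hz hw) (norm_nonneg _)).trans_eq ?_
      ring
  rw [integral_const_mul] at hb
  refine (mul_le_mul_of_nonneg_left hb (by positivity)).trans_eq ?_
  field_simp
  ring

/-- The gradient is bounded through the local Lipschitz estimate for `poissonExtension φ`, so that no
differentiation under the integral sign is needed. -/
theorem enorm_fderiv_poissonExtension_le (φ : Circle ≃ₜ Circle) {z : ℂ} (hz : ‖z‖ < 1) (c : ℂ) :
    ENNReal.ofReal ‖fderiv ℝ (poissonExtension φ) z‖ ≤ ENNReal.ofReal (2 / Real.pi) *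
      ∫⁻ θ in Ioc 0 (2 * Real.pi),
        ENNReal.ofReal (‖(φ (Circle.exp θ) : ℂ) - c‖ / ‖(Circle.exp θ : ℂ) - z‖ ^ 2) := by
  have hφ : Continuous fun θ : ℝ => (φ (Circle.exp θ) : ℂ) := by fun_prop
  have hne := norm_circleExp_sub_sq_ne_zero hz
  have hI : Integrable (fun θ => ‖(φ (Circle.exp θ) : ℂ) - c‖ / ‖(Circle.exp θ : ℂ) - z‖ ^ 2)
      angleMeasure := integrable_angleMeasure (Continuous.div (by fun_prop) (by fun_prop) hne)
  have hint : 0 ≤ ∫ θ, ‖(φ (Circle.exp θ) : ℂ) - c‖ / ‖(Circle.exp θ : ℂ) - z‖ ^ 2 ∂angleMeasure :=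
    integral_nonneg fun θ => by positivity
  have h1 : ‖fderiv ℝ (poissonExtension φ) z‖ ≤ 2 / Real.pi *
      ∫ θ, ‖(φ (Circle.exp θ) : ℂ) - c‖ / ‖(Circle.exp θ : ℂ) - z‖ ^ 2 ∂angleMeasure := by
    refine norm_fderiv_le_of_lip' ℝ (by positivity) ?_
    filter_upwards [Metric.closedBall_mem_nhds z (half_pos (sub_pos.2 hz))] with w hw
    exact norm_poissonExtension_sub_le φ hz (by simpa [dist_eq_norm] using hw) c
  refine (ENNReal.ofReal_le_ofReal h1).trans_eq ?_
  rw [ENNReal.ofReal_mul (by positivity), ofReal_integral_eq_lintegral_ofReal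
    hI (ae_of_all _ fun θ => by positivity)]
  rfl

theorem setLIntegral_Ioc_eq_of_periodic {f : ℝ → ℝ≥0∞} {T : ℝ} (hT : 0 < T)
    (hf : Function.Periodic f T) (a b : ℝ) :
    ∫⁻ x in Ioc a (a + T), f x = ∫⁻ x in Ioc b (b + T), f x := by
  have : VAddInvariantMeasure (AddSubgroup.zmultiples T) ℝ volume :=
    ⟨fun c s _ => measure_preimage_add _ _ _⟩
  refine (isAddFundamentalDomain_Ioc hT a).setLIntegral_eq (isAddFundamentalDomain_Ioc hT b) f ?_
  exact fun g x => hf.map_vadd_zmultiples g x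

theorem setLIntegral_comp_add_left (f : ℝ → ℝ≥0∞) (a b c : ℝ) :
    ∫⁻ x in Ioc a b, f (c + x) = ∫⁻ x in Ioc (c + a) (c + b), f x := by
  rw [← lintegral_indicator measurableSet_Ioc, ← lintegral_indicator measurableSet_Ioc,
    ← lintegral_add_left_eq_self ((Ioc (c + a) (c + b)).indicator f) c]
  congr 1 with x
  simp [indicator]

theorem le_norm_circleExp_sub_real {r t : ℝ} (hr : r ≤ 1) (hr0 : 0 ≤ r) (ht : |t| ≤ Real.pi) :
    (1 - r + |t|) / 5 ≤ ‖(Circle.exp t : ℂ) - r‖ := by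
  have h1 : 1 - r ≤ ‖(Circle.exp t : ℂ) - r‖ := by
    have := norm_sub_norm_le (Circle.exp t : ℂ) r
    rwa [Circle.norm_coe, Complex.norm_real, Real.norm_of_nonneg hr0] at this
  have h2 : ‖(Circle.exp t : ℂ) - 1‖ ≤ ‖(Circle.exp t : ℂ) - r‖ + (1 - r) := by
    have := norm_sub_le_norm_sub_add_norm_sub (Circle.exp t : ℂ) r 1
    have h3 : ‖(r : ℂ) - 1‖ = 1 - r := by
      rw [← Complex.ofReal_one, ← Complex.ofReal_sub, Complex.norm_real, Real.norm_eq_abs,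
        abs_of_nonpos (by linarith)]
      ring
    linarith
  have h3 : 2 / Real.pi * |t| ≤ ‖(Circle.exp t : ℂ) - 1‖ := by
    rw [Circle.coe_exp, mul_comm (t : ℂ), Complex.norm_exp_I_mul_ofReal_sub_one, norm_mul,
      Real.norm_eq_abs (Real.sin _), Real.norm_of_nonneg zero_le_two]
    have := Real.mul_abs_le_abs_sin (x := t / 2) (by rw [abs_div, abs_two]; linarith)
    rw [abs_div, abs_two] at this
    linarith
  have h4 : |t| ≤ Real.pi * ‖(Circle.exp t : ℂ) - r‖ := by
    have h5 : 2 / Real.pi * |t| ≤ 2 * ‖(Circle.exp t : ℂ) - r‖ := by linarith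
    have := Real.pi_pos
    field_simp at h5
    linarith
  nlinarith [Real.pi_lt_four, norm_nonneg ((Circle.exp t : ℂ) - r)]

theorem norm_circleExp_sub_le (a b : ℝ) : ‖(Circle.exp a : ℂ) - Circle.exp b‖ ≤ |a - b| := by
  have h : (Circle.exp a : ℂ) - Circle.exp b =
      Circle.exp b * (Complex.exp (Complex.I * ((a - b : ℝ) : ℂ)) - 1) := by
    rw [Circle.coe_exp, Circle.coe_exp, mul_sub, ← Complex.exp_add, mul_one]
    congr 2
    push_cast
    ring
  rw [h, norm_mul, Circle.norm_coe, one_mul]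
  exact Real.norm_exp_I_mul_ofReal_sub_one_le

/-- With `δ = 1 - r`, the gradient at `r e^{iθ}` is at most a constant times
`∫_{-π}^{π} |g(θ + t) - g(θ)| (δ + |t|)⁻² dt`. The weight is kept as two factors because Hölder's
inequality is later applied to this splitting. -/
theorem enorm_fderiv_poissonExtension_lift_le {φ : Circle ≃ₜ Circle} {g : ℝ → ℝ}
    (hφ : ∀ x, φ (Circle.exp x) = Circle.exp (g x)) {r : ℝ} (hr0 : 0 ≤ r) (hr : r < 1) (θ : ℝ) :
    ENNReal.ofReal ‖fderiv ℝ (poissonExtension φ) (r * Circle.exp θ)‖ ≤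
      ENNReal.ofReal (2 / Real.pi) * 25 * ∫⁻ t in Ioc (-Real.pi) Real.pi,
        ENNReal.ofReal |g (θ + t) - g θ| * (ENNReal.ofReal (1 - r + |t|))⁻¹ *
          (ENNReal.ofReal (1 - r + |t|))⁻¹ := by
  have hz : ‖(r * Circle.exp θ : ℂ)‖ < 1 := by
    rwa [norm_mul, Circle.norm_coe, Complex.norm_real, Real.norm_of_nonneg hr0, mul_one]
  refine (enorm_fderiv_poissonExtension_le φ hz (φ (Circle.exp θ))).trans ?_
  rw [mul_assoc]
  refine mul_le_mul_right ?_ _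
  set F : ℝ → ℝ≥0∞ := fun x => ENNReal.ofReal (‖(φ (Circle.exp x) : ℂ) - φ (Circle.exp θ)‖ /
    ‖(Circle.exp x : ℂ) - r * Circle.exp θ‖ ^ 2) with hF
  have hper : Function.Periodic F (2 * Real.pi) := fun x => by
    simp only [hF, Circle.periodic_exp x]
  have h1 := setLIntegral_Ioc_eq_of_periodic Real.two_pi_pos hper 0 (θ + -Real.pi)
  rw [zero_add, show θ + -Real.pi + 2 * Real.pi = θ + Real.pi by ring,
    ← setLIntegral_comp_add_left] at h1
  change ∫⁻ x in Ioc 0 (2 * Real.pi), F x ≤ _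
  rw [h1, ← lintegral_const_mul' _ _ (by simp)]
  refine setLIntegral_mono' measurableSet_Ioc fun t ht => ?_
  have hd : 0 < 1 - r + |t| := by positivity [sub_pos.2 hr]
  have hlow : (1 - r + |t|) / 5 ≤ ‖(Circle.exp (θ + t) : ℂ) - r * Circle.exp θ‖ := by
    have h2 : (Circle.exp (θ + t) : ℂ) - r * Circle.exp θ =
        Circle.exp θ * ((Circle.exp t : ℂ) - r) := by
      rw [Circle.exp_add, Circle.coe_mul]
      ring
    rw [h2, norm_mul, Circle.norm_coe, one_mul]
    exact le_norm_circleExp_sub_real hr.le hr0 (abs_le.2 ⟨ht.1.le, ht.2⟩)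
  have h3 : ‖(φ (Circle.exp (θ + t)) : ℂ) - φ (Circle.exp θ)‖ /
      ‖(Circle.exp (θ + t) : ℂ) - r * Circle.exp θ‖ ^ 2 ≤
      25 * (|g (θ + t) - g θ| * (1 - r + |t|)⁻¹ * (1 - r + |t|)⁻¹) := by
    have h4 : ‖(φ (Circle.exp (θ + t)) : ℂ) - φ (Circle.exp θ)‖ ≤ |g (θ + t) - g θ| := by
      rw [hφ, hφ]
      exact norm_circleExp_sub_le _ _
    calc _ ≤ |g (θ + t) - g θ| / ((1 - r + |t|) / 5) ^ 2 := by gcongr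
      _ = _ := by field_simp; ring
  refine (ENNReal.ofReal_le_ofReal h3).trans_eq ?_
  rw [ENNReal.ofReal_mul (by norm_num), ENNReal.ofReal_mul (by positivity),
    ENNReal.ofReal_mul (by positivity), ENNReal.ofReal_inv_of_pos hd]
  norm_num

/-! ### Power integrals and mean increments -/

theorem setLIntegral_comp_abs_le (f : ℝ → ℝ≥0∞) (a : ℝ) (ha : 0 ≤ a) :
    ∫⁻ t in Ioc (-a) a, f |t| ≤ 2 * ∫⁻ t in Ioc 0 a, f t := by
  have h0 : ∫⁻ t in Ioc 0 a, f |t| = ∫⁻ t in Ioc 0 a, f t :=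
    setLIntegral_congr_fun measurableSet_Ioc fun t ht => by simp only [abs_of_pos ht.1]
  have h1 : ∫⁻ t in Ioc (-a) 0, f |t| = ∫⁻ t in Ioc 0 a, f t := by
    rw [← h0, ← restrict_Ico_eq_restrict_Ioc (a := 0), ← lintegral_indicator measurableSet_Ioc,
      ← lintegral_indicator measurableSet_Ico, ← lintegral_neg_eq_self]
    congr 1 with x
    simp only [indicator, mem_Ioc, mem_Ico, abs_neg, neg_lt_neg_iff, neg_nonpos]
    exact if_congr and_comm rfl rfl
  rw [← Ioc_union_Ioc_eq_Ioc (neg_nonpos.2 ha) ha]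
  refine (lintegral_union_le _ _ _).trans_eq ?_
  rw [h0, h1, two_mul]

theorem setLIntegral_Ioi_rpow {c s : ℝ} (hc : 0 < c) (hs : 1 < s) :
    ∫⁻ x in Ioi c, ENNReal.ofReal (x ^ (-s)) = ENNReal.ofReal (c ^ (1 - s) / (s - 1)) := by
  rw [← ofReal_integral_eq_lintegral_ofReal (integrableOn_Ioi_rpow_of_lt (by linarith) hc),
    integral_Ioi_rpow_of_lt (by linarith) hc]
  · congr 1
    rw [show -s + 1 = 1 - s by ring, ← neg_sub 1 s, div_neg, neg_div]
  · filter_upwards [ae_restrict_mem measurableSet_Ioi] with x hx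
    exact Real.rpow_nonneg (hc.le.trans (le_of_lt hx)) _

theorem setLIntegral_Ioc_rpow {c s : ℝ} (hc : 0 ≤ c) (hs : -1 < s) :
    ∫⁻ x in Ioc 0 c, ENNReal.ofReal (x ^ s) = ENNReal.ofReal (c ^ (s + 1) / (s + 1)) := by
  rw [← ofReal_integral_eq_lintegral_ofReal, ← intervalIntegral.integral_of_le hc,
    integral_rpow (Or.inl hs), Real.zero_rpow (by linarith), sub_zero]
  · exact (intervalIntegrable_iff_integrableOn_Ioc_of_le hc).1
      (intervalIntegral.intervalIntegrable_rpow' hs)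
  · filter_upwards [ae_restrict_mem measurableSet_Ioc] with x hx
    exact Real.rpow_nonneg hx.1.le _

theorem setLIntegral_inv_add_abs_rpow_le {d s : ℝ} (hd : 0 < d) (hs : 1 < s) :
    ∫⁻ t in Ioc (-Real.pi) Real.pi, (ENNReal.ofReal (d + |t|))⁻¹ ^ s ≤
      2 * ENNReal.ofReal (d ^ (1 - s) / (s - 1)) := by
  refine (setLIntegral_comp_abs_le (fun t => (ENNReal.ofReal (d + t))⁻¹ ^ s) _
    Real.pi_pos.le).trans ?_
  refine mul_le_mul_right ?_ _
  rw [setLIntegral_comp_add_left (fun x => (ENNReal.ofReal x)⁻¹ ^ s), ← setLIntegral_Ioi_rpow hd hs,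
    add_zero]
  refine (lintegral_mono_set Ioc_subset_Ioi_self).trans_eq ?_
  refine setLIntegral_congr_fun measurableSet_Ioi fun x hx => ?_
  have hx0 : 0 < x := hd.trans hx
  rw [← ENNReal.ofReal_inv_of_pos hx0, ENNReal.ofReal_rpow_of_pos (inv_pos.2 hx0),
    Real.rpow_neg hx0.le, Real.inv_rpow hx0.le]

/-- The integral over the radial variable `δ`; it converges at `δ = 0` because `p > 2`. -/
theorem setLIntegral_rpow_mul_inv_add_rpow_le {p t : ℝ} (hp : 2 < p) (ht : 0 < t) :
    ∫⁻ d in Ioo 0 1, ENNReal.ofReal (d ^ (p - 3)) * (ENNReal.ofReal (d + t))⁻¹ ^ p ≤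
      ENNReal.ofReal ((p - 2)⁻¹ + 2⁻¹) * ENNReal.ofReal (t ^ (-2 : ℝ)) := by
  -- On `d ≤ t` the factor `d + t` is replaced by `t`, on `d > t` by `d`.
  have hsub : Ioo (0 : ℝ) 1 ⊆ Ioc 0 t ∪ Ioi t := fun x hx => by
    rcases le_or_gt x t with h | h
    exacts [Or.inl ⟨hx.1, h⟩, Or.inr h]
  have hpt : ∀ d : ℝ, 0 < d → ENNReal.ofReal (d ^ (p - 3)) * (ENNReal.ofReal (d + t))⁻¹ ^ p =
      ENNReal.ofReal (d ^ (p - 3) * (d + t) ^ (-p)) := fun d hd => by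
    have : 0 < d + t := by positivity
    rw [← ENNReal.ofReal_inv_of_pos this, ENNReal.ofReal_rpow_of_pos (inv_pos.2 this),
      ← ENNReal.ofReal_mul (by positivity), Real.rpow_neg this.le, Real.inv_rpow this.le]
  refine (lintegral_mono_set hsub).trans ((lintegral_union_le _ _ _).trans ?_)
  have h1 : ∫⁻ d in Ioc 0 t, ENNReal.ofReal (d ^ (p - 3)) * (ENNReal.ofReal (d + t))⁻¹ ^ p ≤
      ENNReal.ofReal ((p - 2)⁻¹ * t ^ (-2 : ℝ)) := by
    calc _ ≤ ∫⁻ d in Ioc 0 t, ENNReal.ofReal (t ^ (-p)) * ENNReal.ofReal (d ^ (p - 3)) := by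
          refine setLIntegral_mono' measurableSet_Ioc fun d hd => ?_
          have hd0 : 0 < d := hd.1
          rw [hpt d hd0, ← ENNReal.ofReal_mul (by positivity), mul_comm]
          refine ENNReal.ofReal_le_ofReal (mul_le_mul_of_nonneg_right ?_ (by positivity))
          exact Real.rpow_le_rpow_of_nonpos ht (by linarith) (by linarith)
      _ = _ := by
          rw [lintegral_const_mul' _ _ ENNReal.ofReal_ne_top,
            setLIntegral_Ioc_rpow ht.le (by linarith), ← ENNReal.ofReal_mul (by positivity)]
          congr 1
          rw [show p - 3 + 1 = p - 2 by ring, ← mul_div_assoc, ← Real.rpow_add ht]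
          rw [show -p + (p - 2) = -2 by ring, div_eq_inv_mul]
  have h2 : ∫⁻ d in Ioi t, ENNReal.ofReal (d ^ (p - 3)) * (ENNReal.ofReal (d + t))⁻¹ ^ p ≤
      ENNReal.ofReal (2⁻¹ * t ^ (-2 : ℝ)) := by
    calc _ ≤ ∫⁻ d in Ioi t, ENNReal.ofReal (d ^ (-3 : ℝ)) := by
          refine setLIntegral_mono' measurableSet_Ioi fun d hd => ?_
          have hd0 : 0 < d := ht.trans hd
          rw [hpt d hd0]
          refine ENNReal.ofReal_le_ofReal ?_
          rw [show (-3 : ℝ) = (p - 3) + -p by ring, Real.rpow_add hd0]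
          refine mul_le_mul_of_nonneg_left ?_ (by positivity)
          exact Real.rpow_le_rpow_of_nonpos hd0 (by linarith) (by linarith)
      _ = _ := by
          rw [setLIntegral_Ioi_rpow ht (by norm_num)]
          norm_num [div_eq_inv_mul]
  refine (add_le_add h1 h2).trans_eq ?_
  have : 0 < p - 2 := by linarith
  rw [← ENNReal.ofReal_add (by positivity) (by positivity), ← ENNReal.ofReal_mul (by positivity),
    add_mul]

/-- The mean increment of a monotone lift depends only on its degree: `g - id` is periodic, so it
contributes nothing to the integral over a period. -/
theorem setLIntegral_abs_lift_sub {g : ℝ → ℝ} (hg : Continuous g) (hm : Monotone g)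
    (hper : ∀ x, g (x + 2 * Real.pi) = g x + 2 * Real.pi) (t : ℝ) :
    ∫⁻ θ in Ioo (-Real.pi) Real.pi, ENNReal.ofReal |g (θ + t) - g θ| =
      ENNReal.ofReal (2 * Real.pi * |t|) := by
  set u : ℝ → ℝ := fun x => g x - x with hu
  have huc : Continuous u := by fun_prop
  have hup : Function.Periodic u (2 * Real.pi) := fun x => by
    simp only [hu, hper]; ring
  have hI : ∫ θ in (-Real.pi)..Real.pi, (g (θ + t) - g θ) = 2 * Real.pi * t := by
    have h1 : ∀ θ, g (θ + t) - g θ = (u (θ + t) - u θ) + t := fun θ => by simp only [hu]; ring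
    simp only [h1]
    rw [intervalIntegral.integral_add, intervalIntegral.integral_sub,
      intervalIntegral.integral_comp_add_right, intervalIntegral.integral_const]
    · have h2 := hup.intervalIntegral_add_eq (-Real.pi) (-Real.pi + t)
      rw [show -Real.pi + 2 * Real.pi = Real.pi by ring,
        show -Real.pi + t + 2 * Real.pi = Real.pi + t by ring] at h2
      rw [h2, sub_self, smul_eq_mul]
      ring
    all_goals exact Continuous.intervalIntegrable (by fun_prop) _ _
  have hAbs : ∫ θ in (-Real.pi)..Real.pi, |g (θ + t) - g θ| = 2 * Real.pi * |t| := by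
    rcases le_total 0 t with ht | ht
    · rw [abs_of_nonneg ht, ← hI]
      congr 1 with θ
      exact abs_of_nonneg (sub_nonneg.2 (hm (by linarith)))
    · rw [abs_of_nonpos ht, mul_neg, ← hI, ← intervalIntegral.integral_neg]
      congr 1 with θ
      exact abs_of_nonpos (sub_nonpos.2 (hm (by linarith)))
  rw [← hAbs, restrict_Ioo_eq_restrict_Ioc, intervalIntegral.integral_of_le (by linarith [Real.pi_pos]),
    ofReal_integral_eq_lintegral_ofReal (Continuous.integrableOn_Ioc (by fun_prop))
      (ae_of_all _ fun θ => abs_nonneg _)]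

/-! ### The energy of a Poisson extension -/

/-- Hölder's inequality with the weight `(δ + |t|)⁻¹`, where `δ = 1 - r`: its conjugate power
integrates to a multiple of `δ ^ (-1 / (p - 1))`, whose `(p - 1)`-th power is the factor `δ⁻¹`. -/
theorem exists_enorm_fderiv_rpow_le {p : ℝ} (hp : 2 < p) : ∃ K : ℝ≥0∞, K ≠ ⊤ ∧
    ∀ (φ : Circle ≃ₜ Circle) (g : ℝ → ℝ), Continuous g →
      (∀ x, φ (Circle.exp x) = Circle.exp (g x)) → ∀ r : ℝ, 0 ≤ r → r < 1 → ∀ θ : ℝ,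
        ENNReal.ofReal ‖fderiv ℝ (poissonExtension φ) (r * Circle.exp θ)‖ ^ p ≤
          K * (ENNReal.ofReal (1 - r))⁻¹ * ∫⁻ t in Ioc (-Real.pi) Real.pi,
            ENNReal.ofReal |g (θ + t) - g θ| ^ p * (ENNReal.ofReal (1 - r + |t|))⁻¹ ^ p := by
  have hp1 : 1 < p := by linarith
  have hq : p.HolderConjugate (p / (p - 1)) := Real.HolderConjugate.conjExponent hp1
  set s := p / (p - 1) with hs
  have hs1 : s - 1 = (p - 1)⁻¹ := by
    rw [hs]
    field_simp [show p - 1 ≠ 0 by linarith]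
    ring
  refine ⟨(ENNReal.ofReal (2 / Real.pi) * 25) ^ p * (2 * ENNReal.ofReal (p - 1)) ^ (p - 1), ?_, ?_⟩
  · refine ENNReal.mul_ne_top (ENNReal.rpow_ne_top_of_nonneg (by linarith) ?_)
      (ENNReal.rpow_ne_top_of_nonneg (by linarith) ?_)
    · exact ENNReal.mul_ne_top ENNReal.ofReal_ne_top (by simp)
    · exact ENNReal.mul_ne_top (by simp) ENNReal.ofReal_ne_top
  intro φ g hg hφ r hr0 hr θ
  have hd : 0 < 1 - r := sub_pos.2 hr
  set w : ℝ → ℝ≥0∞ := fun t => (ENNReal.ofReal (1 - r + |t|))⁻¹ with hw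
  set D : ℝ → ℝ≥0∞ := fun t => ENNReal.ofReal |g (θ + t) - g θ| with hD
  have hH := ENNReal.lintegral_mul_le_Lp_mul_Lq (volume.restrict (Ioc (-Real.pi) Real.pi)) hq
    (f := fun t => D t * w t) (g := w) (by fun_prop) (by fun_prop)
  have hW : (∫⁻ t in Ioc (-Real.pi) Real.pi, w t ^ s) ^ (p - 1) ≤
      (2 * ENNReal.ofReal (p - 1)) ^ (p - 1) * (ENNReal.ofReal (1 - r))⁻¹ := by
    have h1 := setLIntegral_inv_add_abs_rpow_le hd hq.symm.lt
    refine (ENNReal.rpow_le_rpow h1 (by linarith)).trans_eq ?_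
    rw [show 1 - s = -(p - 1)⁻¹ by linarith, hs1, div_inv_eq_mul, mul_comm (_ ^ _) (p - 1),
      ENNReal.ofReal_mul (by linarith), ← mul_assoc, ENNReal.mul_rpow_of_nonneg _ _ (by linarith)]
    congr 1
    rw [ENNReal.ofReal_rpow_of_pos (by positivity), ← Real.rpow_mul hd.le, neg_mul,
      inv_mul_cancel₀ (by linarith), Real.rpow_neg_one, ENNReal.ofReal_inv_of_pos hd]
  calc _ ≤ (ENNReal.ofReal (2 / Real.pi) * 25 *
        ∫⁻ t in Ioc (-Real.pi) Real.pi, D t * w t * w t) ^ p :=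
        ENNReal.rpow_le_rpow (enorm_fderiv_poissonExtension_lift_le hφ hr0 hr θ) (by linarith)
    _ ≤ (ENNReal.ofReal (2 / Real.pi) * 25 *
        ((∫⁻ t in Ioc (-Real.pi) Real.pi, (D t * w t) ^ p) ^ (1 / p) *
          (∫⁻ t in Ioc (-Real.pi) Real.pi, w t ^ s) ^ (1 / s))) ^ p := by
        gcongr
        exact hH
    _ = (ENNReal.ofReal (2 / Real.pi) * 25) ^ p *
        ((∫⁻ t in Ioc (-Real.pi) Real.pi, (D t * w t) ^ p) *
          (∫⁻ t in Ioc (-Real.pi) Real.pi, w t ^ s) ^ (p - 1)) := by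
        generalize ENNReal.ofReal (2 / Real.pi) * 25 = c
        rw [ENNReal.mul_rpow_of_nonneg _ _ (by linarith), ENNReal.mul_rpow_of_nonneg _ _ (by linarith),
          ← ENNReal.rpow_mul, ← ENNReal.rpow_mul, one_div_mul_cancel (by linarith), ENNReal.rpow_one]
        congr 3
        rw [hs]
        field_simp
    _ ≤ (ENNReal.ofReal (2 / Real.pi) * 25) ^ p *
        ((∫⁻ t in Ioc (-Real.pi) Real.pi, (D t * w t) ^ p) *
          ((2 * ENNReal.ofReal (p - 1)) ^ (p - 1) * (ENNReal.ofReal (1 - r))⁻¹)) := by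
        gcongr
    _ = _ := by
        simp only [ENNReal.mul_rpow_of_nonneg _ _ (show 0 ≤ p by linarith)]
        ring

theorem lintegral_ball_eq_polar (f : ℂ → ℝ≥0∞) :
    ∫⁻ z in Metric.ball (0 : ℂ) 1, f z = ∫⁻ x in Ioo (0 : ℝ) 1 ×ˢ Ioo (-Real.pi) Real.pi,
      ENNReal.ofReal x.1 * f (x.1 * Circle.exp x.2) := by
  rw [← lintegral_indicator Metric.isOpen_ball.measurableSet, ← Complex.lintegral_comp_polarCoord_symm,
    ← lintegral_indicator polarCoord.open_target.measurableSet,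
    ← lintegral_indicator (measurableSet_Ioo.prod measurableSet_Ioo)]
  congr 1 with x
  have hsymm : Complex.polarCoord.symm x = x.1 * Circle.exp x.2 := by
    rw [Complex.polarCoord_symm_apply, Circle.coe_exp, Complex.exp_mul_I, Complex.ofReal_cos,
      Complex.ofReal_sin]
  have hT : x ∈ polarCoord.target ↔ 0 < x.1 ∧ x.2 ∈ Ioo (-Real.pi) Real.pi := by
    simp [polarCoord]
  have hn : ‖(x.1 * Circle.exp x.2 : ℂ)‖ = |x.1| := by
    rw [norm_mul, Circle.norm_coe, Complex.norm_real, Real.norm_eq_abs, mul_one]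
  by_cases h1 : x ∈ polarCoord.target
  · obtain ⟨h2, h3⟩ := hT.1 h1
    rw [indicator_of_mem (by exact h1), hsymm, smul_eq_mul]
    by_cases h4 : x.1 < 1
    · rw [indicator_of_mem, indicator_of_mem]
      · exact ⟨⟨h2, h4⟩, h3⟩
      · rw [mem_ball_zero_iff, hn, abs_of_pos h2]
        exact h4
    · rw [indicator_of_notMem, indicator_of_notMem, mul_zero]
      · exact fun h => h4 h.1.2
      · rw [mem_ball_zero_iff, hn, abs_of_pos h2]
        exact h4
  · rw [indicator_of_notMem (by exact h1), indicator_of_notMem]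
    exact fun h => h1 (hT.2 ⟨h.1.1, h.2⟩)

theorem setLIntegral_one_sub (f : ℝ → ℝ≥0∞) :
    ∫⁻ r in Ioo (0 : ℝ) 1, f (1 - r) = ∫⁻ d in Ioo (0 : ℝ) 1, f d := by
  rw [← lintegral_indicator measurableSet_Ioo, ← lintegral_indicator measurableSet_Ioo,
    ← lintegral_sub_left_eq_self ((Ioo (0 : ℝ) 1).indicator f) 1]
  congr 1 with x
  simp only [indicator, mem_Ioo, sub_pos, sub_lt_self_iff]
  exact if_congr and_comm rfl rfl

/-- The energy of the harmonic extension is controlled by the Besov seminorm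
`∬ |g(θ + t) - g(θ)|^p t⁻² dθ dt`. For a monotone lift `g` with modulus of continuity `Ω` the inner
integral is at most `2πt Ω(t)^(p - 1)`, so that `∫ Ω(t)^(p - 1) dt / t < ∞` suffices. -/
theorem lintegral_fderiv_poissonExtension_lt_top {p : ℝ} (hp : 2 < p) {φ : Circle ≃ₜ Circle}
    {g : ℝ → ℝ} (hg : Continuous g) (hm : Monotone g)
    (hper : ∀ x, g (x + 2 * Real.pi) = g x + 2 * Real.pi)
    (hφ : ∀ x, φ (Circle.exp x) = Circle.exp (g x)) {Ω : ℝ → ℝ≥0∞}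
    (hΩ : ∀ x t, 0 < t → ENNReal.ofReal (g (x + t) - g x) ≤ Ω t)
    (hI : ∫⁻ t in Ioc 0 Real.pi, Ω t ^ (p - 1) * (ENNReal.ofReal t)⁻¹ < ⊤) :
    ∫⁻ z in Metric.ball (0 : ℂ) 1, ENNReal.ofReal
      (‖fderiv ℝ (poissonExtension φ) z‖ ^ p * (1 - ‖z‖) ^ (p - 2)) < ⊤ := by
  obtain ⟨K, hK, hKb⟩ := exists_enorm_fderiv_rpow_le hp
  set C : ℝ≥0∞ := ENNReal.ofReal ((p - 2)⁻¹ + 2⁻¹) with hC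
  set D : ℝ → ℝ → ℝ≥0∞ := fun θ t => ENNReal.ofReal |g (θ + t) - g θ| with hD
  set a : ℝ → ℝ → ℝ≥0∞ := fun d t =>
    ENNReal.ofReal (d ^ (p - 3)) * (ENNReal.ofReal (d + |t|))⁻¹ ^ p with ha
  have hmeas : Measurable fun y : (ℝ × ℝ) × ℝ => a (1 - y.1.1) y.2 * D y.1.2 y.2 ^ p := by
    simp only [ha, hD]
    fun_prop
  have hΩ' : ∀ θ t, t ≠ 0 → D θ t ≤ Ω |t| := fun θ t ht => by
    rcases lt_or_gt_of_ne ht with h | h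
    · have := hΩ (θ + t) (-t) (by linarith)
      rw [add_neg_cancel_right] at this
      simp only [hD]
      rwa [abs_of_nonpos (sub_nonpos.2 (hm (by linarith))), neg_sub, abs_of_neg h]
    · simp only [hD]
      rw [abs_of_nonneg (sub_nonneg.2 (hm (by linarith))), abs_of_pos h]
      exact hΩ θ t h
  -- The modulus of continuity absorbs all but one power of the increment, and the remaining one
  -- has a known mean.
  have hDp : ∀ t, t ≠ 0 → ∫⁻ θ in Ioo (-Real.pi) Real.pi, D θ t ^ p ≤
      Ω |t| ^ (p - 1) * ENNReal.ofReal (2 * Real.pi * |t|) := fun t ht => by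
    rw [← setLIntegral_abs_lift_sub hg hm hper t, ← lintegral_const_mul _ (by fun_prop)]
    refine lintegral_mono fun θ => ?_
    have : D θ t ^ p = D θ t ^ (p - 1) * D θ t := by
      conv_lhs => rw [show p = (p - 1) + 1 by ring]
      rw [ENNReal.rpow_add_of_nonneg _ _ (by linarith) zero_le_one, ENNReal.rpow_one]
    rw [this]
    exact mul_le_mul_left (ENNReal.rpow_le_rpow (hΩ' θ t ht) (by linarith)) _
  calc _ ≤ ∫⁻ x in Ioo (0 : ℝ) 1 ×ˢ Ioo (-Real.pi) Real.pi,
          K * ∫⁻ t in Ioc (-Real.pi) Real.pi, a (1 - x.1) t * D x.2 t ^ p := by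
        rw [lintegral_ball_eq_polar]
        refine setLIntegral_mono' (measurableSet_Ioo.prod measurableSet_Ioo) fun x hx => ?_
        obtain ⟨⟨h0, h1⟩, -⟩ := hx
        have hd : 0 < 1 - x.1 := sub_pos.2 h1
        have hn : ‖(x.1 * Circle.exp x.2 : ℂ)‖ = x.1 := by
          rw [norm_mul, Circle.norm_coe, Complex.norm_real, Real.norm_of_nonneg h0.le, mul_one]
        rw [hn, ENNReal.ofReal_mul (by positivity),
          ← ENNReal.ofReal_rpow_of_nonneg (norm_nonneg _) (by linarith)]
        have hb := hKb φ g hg hφ x.1 h0.le h1 x.2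
        calc _ ≤ 1 * (K * (ENNReal.ofReal (1 - x.1))⁻¹ * (∫⁻ t in Ioc (-Real.pi) Real.pi,
                ENNReal.ofReal |g (x.2 + t) - g x.2| ^ p *
                  (ENNReal.ofReal (1 - x.1 + |t|))⁻¹ ^ p) *
                ENNReal.ofReal ((1 - x.1) ^ (p - 2))) := by
              gcongr
              exact ENNReal.ofReal_le_one.2 h1.le
          _ = K * (((ENNReal.ofReal (1 - x.1))⁻¹ * ENNReal.ofReal ((1 - x.1) ^ (p - 2))) *
                ∫⁻ t in Ioc (-Real.pi) Real.pi, ENNReal.ofReal |g (x.2 + t) - g x.2| ^ p *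
                  (ENNReal.ofReal (1 - x.1 + |t|))⁻¹ ^ p) := by ring
          _ = _ := by
              rw [← ENNReal.ofReal_inv_of_pos hd, ← ENNReal.ofReal_mul (by positivity),
                ← Real.rpow_neg_one, ← Real.rpow_add hd, show -1 + (p - 2) = p - 3 by ring,
                ← lintegral_const_mul' _ _ ENNReal.ofReal_ne_top]
              congr 2 with t
              simp only [ha, hD]
              ring
    _ = K * ∫⁻ x in Ioo (0 : ℝ) 1 ×ˢ Ioo (-Real.pi) Real.pi,
          ∫⁻ t in Ioc (-Real.pi) Real.pi, a (1 - x.1) t * D x.2 t ^ p :=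
        lintegral_const_mul' _ _ hK
    _ = K * ∫⁻ t in Ioc (-Real.pi) Real.pi, (∫⁻ d in Ioo (0 : ℝ) 1, a d t) *
          ∫⁻ θ in Ioo (-Real.pi) Real.pi, D θ t ^ p := by
        rw [lintegral_lintegral_swap hmeas.aemeasurable]
        congr 2 with t
        rw [Measure.volume_eq_prod, ← Measure.prod_restrict,
          lintegral_prod_mul (f := fun r => a (1 - r) t) (g := fun θ => D θ t ^ p)
            (by simp only [ha]; fun_prop) (by simp only [hD]; fun_prop),
          setLIntegral_one_sub fun d => a d t]
    _ ≤ K * ∫⁻ t in Ioc (-Real.pi) Real.pi, C * ENNReal.ofReal (2 * Real.pi) *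
          (Ω |t| ^ (p - 1) * (ENNReal.ofReal |t|)⁻¹) := by
        refine mul_le_mul_right (lintegral_mono_ae ?_) _
        filter_upwards [(Measure.ae_ne volume (0 : ℝ)).filter_mono
          (ae_mono Measure.restrict_le_self)] with t ht
        have ht0 : 0 < |t| := abs_pos.2 ht
        calc _ ≤ (C * ENNReal.ofReal (|t| ^ (-2 : ℝ))) *
              (Ω |t| ^ (p - 1) * ENNReal.ofReal (2 * Real.pi * |t|)) :=
              mul_le_mul' (setLIntegral_rpow_mul_inv_add_rpow_le hp ht0) (hDp t ht)
          _ = C * Ω |t| ^ (p - 1) *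
              (ENNReal.ofReal (|t| ^ (-2 : ℝ)) * ENNReal.ofReal (2 * Real.pi * |t|)) := by ring
          _ = C * Ω |t| ^ (p - 1) * (ENNReal.ofReal (2 * Real.pi) * (ENNReal.ofReal |t|)⁻¹) := by
              rw [← ENNReal.ofReal_inv_of_pos ht0, ← ENNReal.ofReal_mul (by positivity),
                ← ENNReal.ofReal_mul (by positivity)]
              congr 2
              rw [Real.rpow_neg ht0.le, Real.rpow_two]
              field_simp
          _ = _ := by ring
    _ ≤ K * (C * ENNReal.ofReal (2 * Real.pi) *
          (2 * ∫⁻ t in Ioc 0 Real.pi, Ω t ^ (p - 1) * (ENNReal.ofReal t)⁻¹)) := by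
        rw [lintegral_const_mul' _ _ (ENNReal.mul_ne_top ENNReal.ofReal_ne_top
          ENNReal.ofReal_ne_top)]
        gcongr
        exact setLIntegral_comp_abs_le (fun t => Ω t ^ (p - 1) * (ENNReal.ofReal t)⁻¹) _
          Real.pi_pos.le
    _ < ⊤ := by
        refine ENNReal.mul_lt_top hK.lt_top (ENNReal.mul_lt_top (ENNReal.mul_lt_top
          ENNReal.ofReal_lt_top ENNReal.ofReal_lt_top) (ENNReal.mul_lt_top (by simp) hI))

/-! ### Circle homeomorphisms from lifts -/

theorem lift_add_int_mul {g : ℝ → ℝ} (hper : ∀ x, g (x + 2 * Real.pi) = g x + 2 * Real.pi)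
    (x : ℝ) (n : ℤ) : g (x + n * (2 * Real.pi)) = g x + n * (2 * Real.pi) := by
  have hp : Function.Periodic (fun y => g y - y) (2 * Real.pi) := fun y => by
    simp only [hper]; ring
  have := hp.int_mul n x
  linarith

theorem exists_circleHomeomorph_of_lift {g : ℝ → ℝ} (hg : Continuous g) (hm : StrictMono g)
    (hper : ∀ x, g (x + 2 * Real.pi) = g x + 2 * Real.pi) :
    ∃ φ : Circle ≃ₜ Circle, ∀ x, φ (Circle.exp x) = Circle.exp (g x) := by
  have hP : Function.Periodic (fun x => Circle.exp (g x)) (2 * Real.pi) := fun x => by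
    simp only [hper, Circle.periodic_exp (g x)]
  let f : Circle → Circle := fun z => hP.lift (AddCircle.homeomorphCircle'.symm z)
  have hf : ∀ x, f (Circle.exp x) = Circle.exp (g x) := fun x => by
    have : AddCircle.homeomorphCircle'.symm (Circle.exp x) = (x : AddCircle (2 * Real.pi)) := by
      rw [Homeomorph.symm_apply_eq, AddCircle.homeomorphCircle'_apply_mk]
    simp only [f, this, Function.Periodic.lift_coe]
  have hfc : Continuous f := by
    refine Continuous.comp ?_ (Homeomorph.continuous _)
    exact Continuous.quotient_lift (by fun_prop) _
  have hsurj : Function.Surjective g := by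
    intro y
    obtain ⟨n, hn⟩ := exists_nat_ge (|y - g 0| / (2 * Real.pi))
    rw [div_le_iff₀ Real.two_pi_pos] at hn
    have h1 := lift_add_int_mul hper 0 n
    have h2 := lift_add_int_mul hper 0 (-n)
    push_cast at h1 h2
    obtain ⟨x, -, hx⟩ := intermediate_value_Icc (f := g) (a := 0 + -(n : ℝ) * (2 * Real.pi))
      (b := 0 + n * (2 * Real.pi)) (by nlinarith [abs_nonneg (y - g 0)]) hg.continuousOn
      (show y ∈ _ by
        rw [h1, h2]
        constructor <;> nlinarith [neg_abs_le (y - g 0), le_abs_self (y - g 0)])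
    exact ⟨x, hx⟩
  have hinj : Function.Injective f := by
    intro z w hzw
    obtain ⟨a, rfl⟩ : ∃ a, Circle.exp a = z := ⟨_, Circle.exp_arg z⟩
    obtain ⟨b, rfl⟩ : ∃ b, Circle.exp b = w := ⟨_, Circle.exp_arg w⟩
    rw [hf, hf, Circle.exp_eq_exp] at hzw
    obtain ⟨n, hn⟩ := hzw
    rw [← lift_add_int_mul hper] at hn
    exact Circle.exp_eq_exp.2 ⟨n, hm.injective hn⟩
  have hfs : Function.Surjective f := by
    intro z
    obtain ⟨a, rfl⟩ : ∃ a, Circle.exp a = z := ⟨_, Circle.exp_arg z⟩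
    obtain ⟨b, rfl⟩ := hsurj a
    exact ⟨Circle.exp b, hf b⟩
  exact ⟨Continuous.homeoOfEquivCompactToT2 (f := Equiv.ofBijective f ⟨hinj, hfs⟩) hfc, hf⟩

/-! ### The logarithmic potential of the inverse -/

/-- For `α = p - 2` and `λ = 0` the density of the kernel is `1 / x`. -/
theorem logKernel_critical (p t : ℝ) : logKernel p (p - 2) 0 t =
    extIntegral (volume.restrict (Ioc t 1)) (fun x : ℝ => ((x⁻¹ : ℝ) : EReal)) -
      extIntegral (volume.restrict (Ioc 1 t)) (fun x : ℝ => ((x⁻¹ : ℝ) : EReal)) := by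
  simp only [logKernel, Real.rpow_zero, mul_one, show 1 + (p - 2) - p = -1 by ring,
    Real.rpow_neg_one]

theorem extIntegral_of_nonneg {s : Set ℝ} (hs : MeasurableSet s) {f : ℝ → ℝ}
    (hf : ∀ x ∈ s, 0 ≤ f x) : extIntegral (volume.restrict s) (fun x => (f x : EReal)) =
      ((∫⁻ x in s, ENNReal.ofReal (f x) : ℝ≥0∞) : EReal) := by
  have h : ∫⁻ x in s, (-(f x : EReal)).toENNReal = 0 := by
    rw [setLIntegral_congr_fun hs (g := fun _ => 0) fun x hx => ?_, lintegral_zero]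
    exact EReal.toENNReal_of_nonpos (by simpa using hf x hx)
  rw [extIntegral, h]
  simp

theorem logKernel_of_le_one {p t : ℝ} (h0 : 0 ≤ t) (h1 : t ≤ 1) : logKernel p (p - 2) 0 t =
    ((∫⁻ x in Ioc t 1, ENNReal.ofReal x⁻¹ : ℝ≥0∞) : EReal) := by
  rw [logKernel_critical, extIntegral_of_nonneg measurableSet_Ioc
    fun x hx => inv_nonneg.2 (h0.trans hx.1.le), Ioc_eq_empty (not_lt.2 h1)]
  simp [extIntegral]

theorem logKernel_of_one_le {p t : ℝ} (h1 : 1 ≤ t) : logKernel p (p - 2) 0 t =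
    -((∫⁻ x in Ioc 1 t, ENNReal.ofReal x⁻¹ : ℝ≥0∞) : EReal) := by
  rw [logKernel_critical, extIntegral_of_nonneg (s := Ioc 1 t) measurableSet_Ioc
    fun x hx => inv_nonneg.2 (zero_le_one.trans hx.1.le), Ioc_eq_empty (not_lt.2 h1)]
  simp [extIntegral]

theorem ofReal_log_le_logKernel {p t η : ℝ} (h0 : 0 ≤ t) (ht : t ≤ η) (hη : 0 < η) (h1 : η ≤ 1) :
    ENNReal.ofReal (Real.log η⁻¹) ≤ (logKernel p (p - 2) 0 t).toENNReal := by
  rw [logKernel_of_le_one h0 (ht.trans h1), EReal.toENNReal_coe]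
  refine le_trans ?_ (lintegral_mono_set (Ioc_subset_Ioc_left ht))
  rw [← ofReal_integral_eq_lintegral_ofReal, ← intervalIntegral.integral_of_le h1,
    integral_inv_of_pos hη one_pos, one_div]
  · refine ((continuousOn_inv₀ (G₀ := ℝ)).mono fun x hx => ?_).integrableOn_Icc.mono_set
      Ioc_subset_Icc_self
    exact (hη.trans_le hx.1).ne'
  · filter_upwards [ae_restrict_mem measurableSet_Ioc] with x hx
    exact inv_nonneg.2 (hη.le.trans hx.1.le)

theorem neg_logKernel_le_one {p t : ℝ} (h0 : 0 ≤ t) (h2 : t ≤ 2) :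
    (-logKernel p (p - 2) 0 t).toENNReal ≤ 1 := by
  rcases le_total t 1 with h1 | h1
  · rw [logKernel_of_le_one h0 h1, EReal.toENNReal_of_nonpos]
    · exact zero_le_one
    · simpa using EReal.coe_ennreal_nonneg _
  · rw [logKernel_of_one_le h1, neg_neg, EReal.toENNReal_coe]
    calc _ ≤ ∫⁻ x in Ioc 1 t, (1 : ℝ≥0∞) := setLIntegral_mono' measurableSet_Ioc fun x hx =>
          ENNReal.ofReal_le_one.2 (inv_le_one_of_one_le₀ hx.1.le)
      _ ≤ 1 := by
          rw [setLIntegral_one, Real.volume_Ioc]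
          exact ENNReal.ofReal_le_one.2 (by linarith)

/-- Chords have length at most `2`, so the negative part of the kernel costs at most `2π`. -/
theorem le_innerPotential {p : ℝ} {φ : Circle ≃ₜ Circle} {ξ : Circle} {A : ℝ≥0∞}
    (hA : A ≤ ∫⁻ t in Ioc 0 (2 * Real.pi),
      (logKernel p (p - 2) 0 ‖(φ.symm ξ : ℂ) - (φ.symm (Circle.exp t) : ℂ)‖).toENNReal) :
    A - ENNReal.ofReal (2 * Real.pi) ≤ (innerPotential p (p - 2) 0 φ ξ).toENNReal := by
  have hneg : ∫⁻ t in Ioc 0 (2 * Real.pi),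
      (-logKernel p (p - 2) 0 ‖(φ.symm ξ : ℂ) - (φ.symm (Circle.exp t) : ℂ)‖).toENNReal ≤
        ENNReal.ofReal (2 * Real.pi) := by
    calc _ ≤ ∫⁻ t in Ioc 0 (2 * Real.pi), (1 : ℝ≥0∞) := lintegral_mono fun t => by
          refine neg_logKernel_le_one (norm_nonneg _) ((norm_sub_le _ _).trans ?_)
          rw [Circle.norm_coe, Circle.norm_coe]
          norm_num
      _ = _ := by rw [setLIntegral_one, Real.volume_Ioc, sub_zero]
  rw [innerPotential, extIntegral, EReal.toENNReal_sub (EReal.coe_ennreal_nonneg _),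
    EReal.toENNReal_coe, EReal.toENNReal_coe]
  exact tsub_le_tsub hA hneg

/-- If `g` gains at least `l` on each of `m` non-overlapping intervals `[a j, b j]` of length at most
`η`, then the potential is at least `l log (1/η) - 2π` on the image of each of them, and these
images have total length at least `m l`. -/
theorem le_inverseEnergy {p : ℝ} (hp : 1 ≤ p) {φ : Circle ≃ₜ Circle} {g : ℝ → ℝ}
    (hg : Continuous g) (hm : Monotone g)
    (hper : ∀ x, g (x + 2 * Real.pi) = g x + 2 * Real.pi) (h0 : g 0 = 0)
    (hφ : ∀ x, φ (Circle.exp x) = Circle.exp (g x)) {m : ℕ} {a b : ℕ → ℝ} {η l : ℝ}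
    (ha : Monotone a) (ha0 : 0 ≤ a 0) (ham : a m ≤ 2 * Real.pi) (hab : ∀ j, a j ≤ b j)
    (hba : ∀ j, b j ≤ a (j + 1)) (hη : ∀ j, b j - a j ≤ η) (hη0 : 0 < η) (hη1 : η ≤ 1)
    (hl : ∀ j, l ≤ g (b j) - g (a j)) :
    m * ENNReal.ofReal l * ENNReal.ofReal (Real.log η⁻¹ * l - 2 * Real.pi) ^ (p - 1) ≤
      inverseEnergy p (p - 2) 0 φ := by
  have h2π : g (2 * Real.pi) = 2 * Real.pi := by
    have := hper 0
    rwa [zero_add, h0, zero_add] at this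
  have hsub : ∀ j < m, Ioc (g (a j)) (g (b j)) ⊆ Ioc 0 (2 * Real.pi) := fun j hj =>
    Ioc_subset_Ioc (h0 ▸ hm (ha0.trans (ha j.zero_le)))
      (h2π ▸ hm ((hba j).trans ((ha hj).trans ham)))
  have hlog : 0 ≤ Real.log η⁻¹ := Real.log_nonneg (one_le_inv₀ hη0 |>.2 hη1)
  have hvol : ∀ j, ENNReal.ofReal l ≤ volume (Ioc (g (a j)) (g (b j))) := fun j => by
    rw [Real.volume_Ioc]
    exact ENNReal.ofReal_le_ofReal (hl j)
  have hpre : ∀ j, ∀ s ∈ Ioc (g (a j)) (g (b j)), ∃ x ∈ Icc (a j) (b j),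
      φ.symm (Circle.exp s) = Circle.exp x := fun j s hs => by
    obtain ⟨x, hx, rfl⟩ := intermediate_value_Icc (hab j) hg.continuousOn (Ioc_subset_Icc_self hs)
    exact ⟨x, hx, by rw [← hφ, φ.symm_apply_apply]⟩
  have hpot : ∀ j < m, ∀ s ∈ Ioc (g (a j)) (g (b j)),
      ENNReal.ofReal (Real.log η⁻¹ * l - 2 * Real.pi) ≤
        (innerPotential p (p - 2) 0 φ (Circle.exp s)).toENNReal := fun j hj s hs => by
    obtain ⟨x, hx, hxs⟩ := hpre j s hs
    rw [ENNReal.ofReal_sub _ Real.two_pi_pos.le]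
    refine le_innerPotential ?_
    calc _ = ENNReal.ofReal (Real.log η⁻¹) * ENNReal.ofReal l := ENNReal.ofReal_mul hlog
      _ ≤ ∫⁻ t in Ioc (g (a j)) (g (b j)), ENNReal.ofReal (Real.log η⁻¹) := by
          rw [setLIntegral_const]
          exact mul_le_mul_right (hvol j) _
      _ ≤ _ := by
          refine le_trans (setLIntegral_mono' measurableSet_Ioc fun t ht => ?_)
            (lintegral_mono_set (hsub j hj))
          obtain ⟨y, hy, hyt⟩ := hpre j t ht
          rw [hxs, hyt]
          refine ofReal_log_le_logKernel (norm_nonneg _) ((norm_circleExp_sub_le x y).trans ?_)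
            hη0 hη1
          exact (abs_sub_le_of_le_of_le hx.1 hx.2 hy.1 hy.2).trans (hη j)
  have hdisj : Set.PairwiseDisjoint (Finset.range m : Set ℕ)
      fun j => Ioc (g (a j)) (g (b j)) := by
    have := (hm.comp ha).pairwise_disjoint_on_Ioc_succ
    exact fun i _ j _ hij => (this hij).mono (Ioc_subset_Ioc_right (hm (hba i)))
      (Ioc_subset_Ioc_right (hm (hba j)))
  have hU : m * ENNReal.ofReal l ≤ volume (⋃ j ∈ Finset.range m, Ioc (g (a j)) (g (b j))) := by
    rw [measure_biUnion_finset hdisj fun _ _ => measurableSet_Ioc]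
    calc _ = ∑ j ∈ Finset.range m, ENNReal.ofReal l := by simp
      _ ≤ _ := Finset.sum_le_sum fun j _ => hvol j
  calc _ ≤ ∫⁻ s in ⋃ j ∈ Finset.range m, Ioc (g (a j)) (g (b j)),
        ENNReal.ofReal (Real.log η⁻¹ * l - 2 * Real.pi) ^ (p - 1) := by
        rw [setLIntegral_const, mul_comm]
        exact mul_le_mul_right hU _
    _ ≤ ∫⁻ s in ⋃ j ∈ Finset.range m, Ioc (g (a j)) (g (b j)),
        (innerPotential p (p - 2) 0 φ (Circle.exp s)).toENNReal ^ (p - 1) := by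
        refine setLIntegral_mono' (Finset.measurableSet_biUnion _ fun _ _ => measurableSet_Ioc)
          fun s hs => ENNReal.rpow_le_rpow ?_ (by linarith)
        simp only [mem_iUnion, Finset.mem_range] at hs
        obtain ⟨j, hj, hs⟩ := hs
        exact hpot j hj s hs
    _ ≤ _ := lintegral_mono_set (iUnion₂_subset fun j hj => hsub j (Finset.mem_range.1 hj))

/-! ### Ramps and combs -/

/-- The piecewise linear degree-one function that climbs from `n` to `n + 1` on `[n, n + ε]` and is
constant on `[n + ε, n + 1]`, for every integer `n`; meaningful for `0 < ε < 1`. -/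
noncomputable def ramp (ε x : ℝ) : ℝ := ⌊x⌋ + min 1 (Int.fract x / ε)

section ramp

variable {ε : ℝ}

theorem le_ramp (h0 : 0 < ε) (h1 : ε < 1) (x : ℝ) : x ≤ ramp ε x := by
  have h : Int.fract x ≤ min 1 (Int.fract x / ε) :=
    le_min (Int.fract_lt_one x).le (le_div_self (Int.fract_nonneg x) h0 h1.le)
  have := Int.floor_add_fract x
  simp only [ramp]
  linarith

theorem ramp_le_floor_add_one (x : ℝ) : ramp ε x ≤ ⌊x⌋ + 1 := by
  simp only [ramp]
  linarith [min_le_left 1 (Int.fract x / ε)]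

theorem floor_le_ramp (h0 : 0 < ε) (x : ℝ) : ⌊x⌋ ≤ ramp ε x := by
  have : 0 ≤ min 1 (Int.fract x / ε) := le_min zero_le_one (by positivity)
  simp only [ramp]
  linarith

theorem ramp_add_int (x : ℝ) (n : ℤ) : ramp ε (x + n) = ramp ε x + n := by
  simp only [ramp, Int.floor_add_intCast, Int.fract_add_intCast]
  push_cast
  ring

theorem ramp_intCast (n : ℤ) : ramp ε n = n := by
  simp [ramp]

theorem ramp_intCast_add (h0 : 0 < ε) (h1 : ε < 1) (n : ℤ) : ramp ε (n + ε) = n + 1 := by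
  have h2 : ⌊ε⌋ = 0 := Int.floor_eq_zero_iff.2 ⟨h0.le, h1⟩
  rw [add_comm (n : ℝ), ramp_add_int, ramp, h2, Int.fract_eq_self.2 ⟨h0.le, h1⟩, div_self h0.ne']
  simp [add_comm]

theorem monotone_ramp (h0 : 0 < ε) : Monotone (ramp ε) := by
  intro x y hxy
  rcases (Int.floor_mono hxy).eq_or_lt with h | h
  · have : Int.fract x ≤ Int.fract y := by
      simp only [Int.fract, h]
      linarith
    simp only [ramp, h]
    gcongr
  · calc ramp ε x ≤ ⌊x⌋ + 1 := ramp_le_floor_add_one x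
      _ ≤ ⌊y⌋ := by exact_mod_cast h
      _ ≤ ramp ε y := floor_le_ramp h0 y

theorem ramp_sub_le_add_one (h0 : 0 < ε) (h1 : ε < 1) (x y : ℝ) :
    ramp ε y - ramp ε x ≤ y - x + 1 := by
  linarith [ramp_le_floor_add_one (ε := ε) y, Int.floor_le y, le_ramp h0 h1 x]

theorem ramp_sub_le_div (h0 : 0 < ε) (h1 : ε < 1) {x y : ℝ} (hxy : x ≤ y) :
    ramp ε y - ramp ε x ≤ (y - x) / ε := by
  have hx := Int.floor_add_fract x
  have hy := Int.floor_add_fract y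
  have hmin : min 1 (Int.fract y / ε) ≤ Int.fract y / ε := min_le_right _ _
  rw [le_div_iff₀ h0]
  have hyε : min 1 (Int.fract y / ε) * ε ≤ Int.fract y := (le_div_iff₀ h0).1 hmin
  simp only [ramp]
  rcases (Int.floor_mono hxy).eq_or_lt with h | h
  · rw [h] at hx ⊢
    rcases le_total 1 (Int.fract x / ε) with h2 | h2
    · rw [min_eq_left h2]
      nlinarith [min_le_left 1 (Int.fract y / ε)]
    · rw [min_eq_right h2]
      have : Int.fract x / ε * ε = Int.fract x := div_mul_cancel₀ _ h0.ne'
      nlinarith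
  · have h3 : (⌊x⌋ : ℝ) + 1 ≤ ⌊y⌋ := by exact_mod_cast h
    have h4 : (1 - min 1 (Int.fract x / ε)) * ε ≤ 1 - Int.fract x := by
      rcases le_total 1 (Int.fract x / ε) with h2 | h2
      · rw [min_eq_left h2]
        linarith [Int.fract_lt_one x]
      · rw [min_eq_right h2, sub_mul, div_mul_cancel₀ _ h0.ne']
        linarith
    nlinarith

theorem continuous_ramp (h0 : 0 < ε) (h1 : ε < 1) : Continuous (ramp ε) := by
  have h : LipschitzWith (Real.toNNReal ε⁻¹) (ramp ε) := by
    refine LipschitzWith.of_le_add_mul _ fun x y => ?_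
    rw [Real.coe_toNNReal _ (inv_nonneg.2 h0.le), Real.dist_eq]
    rcases le_total x y with hxy | hxy
    · have : 0 ≤ ε⁻¹ * |x - y| := by positivity
      linarith [monotone_ramp h0 hxy]
    · have := ramp_sub_le_div h0 h1 hxy
      rw [abs_of_nonneg (sub_nonneg.2 hxy)]
      rw [div_eq_inv_mul] at this
      linarith
  exact h.continuous

end ramp

/-- The lift of degree one with `m` teeth: it climbs by `2π/m` on each interval
`[2πj/m, 2πj/m + η]` and is constant in between. -/
noncomputable def comb (m : ℕ) (η θ : ℝ) : ℝ :=
  2 * Real.pi / m * ramp (m * η / (2 * Real.pi)) (m * θ / (2 * Real.pi))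

/-- The parameters of a nondegenerate comb: there is at least one tooth, and the teeth have positive
width and are separated by gaps. -/
structure IsCombParam (m : ℕ) (η : ℝ) : Prop where
  pos : 0 < m
  width_pos : 0 < η
  width_lt : m * η < 2 * Real.pi

namespace IsCombParam

variable {m : ℕ} {η : ℝ}

theorem ratio_pos (h : IsCombParam m η) : 0 < m * η / (2 * Real.pi) := by
  have h1 := h.pos
  have h2 := h.width_pos
  positivity

theorem ratio_lt (h : IsCombParam m η) : m * η / (2 * Real.pi) < 1 :=
  (div_lt_one Real.two_pi_pos).2 h.width_lt

theorem monotone_comb (h : IsCombParam m η) : Monotone (comb m η) := by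
  intro x y hxy
  refine mul_le_mul_of_nonneg_left (monotone_ramp h.ratio_pos ?_) (by positivity)
  gcongr

theorem continuous_comb (h : IsCombParam m η) : Continuous (comb m η) :=
  continuous_const.mul ((continuous_ramp h.ratio_pos h.ratio_lt).comp (by fun_prop))

theorem comb_add_two_pi (h : IsCombParam m η) (θ : ℝ) :
    comb m η (θ + 2 * Real.pi) = comb m η θ + 2 * Real.pi := by
  have hm : (m : ℝ) ≠ 0 := by exact_mod_cast h.pos.ne'
  have h1 : m * (θ + 2 * Real.pi) / (2 * Real.pi) = m * θ / (2 * Real.pi) + (m : ℤ) := by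
    push_cast
    field_simp
  rw [comb, comb, h1, ramp_add_int]
  push_cast
  field_simp

theorem comb_zero : comb m η 0 = 0 := by
  have := ramp_intCast (ε := m * η / (2 * Real.pi)) 0
  rw [Int.cast_zero] at this
  rw [comb, mul_zero, zero_div, this, mul_zero]

theorem abs_comb_sub_self_le (h : IsCombParam m η) (θ : ℝ) :
    |comb m η θ - θ| ≤ 2 * Real.pi := by
  have hm : (1 : ℝ) ≤ m := by exact_mod_cast h.pos
  have h1 := le_ramp h.ratio_pos h.ratio_lt (m * θ / (2 * Real.pi))
  have h2 := ramp_le_floor_add_one (ε := m * η / (2 * Real.pi)) (m * θ / (2 * Real.pi))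
  have h3 := Int.floor_le (m * θ / (2 * Real.pi))
  have h4 : comb m η θ - θ = 2 * Real.pi / m *
      (ramp (m * η / (2 * Real.pi)) (m * θ / (2 * Real.pi)) - m * θ / (2 * Real.pi)) := by
    rw [comb]
    field_simp
  rw [h4, abs_of_nonneg (mul_nonneg (by positivity) (by linarith))]
  calc _ ≤ 2 * Real.pi / m * 1 := by gcongr; linarith
    _ ≤ 2 * Real.pi := by
      rw [mul_one]
      exact div_le_self Real.two_pi_pos.le hm

theorem comb_add_sub_le (h : IsCombParam m η) (x : ℝ) {t : ℝ} (ht : 0 ≤ t) :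
    comb m η (x + t) - comb m η x ≤ t + 2 * Real.pi / m * min 1 (t / η) := by
  have hm : (0 : ℝ) < m := by exact_mod_cast h.pos
  have hη := h.width_pos
  set ε := m * η / (2 * Real.pi) with hε
  set s := m * t / (2 * Real.pi) with hs
  have hs0 : 0 ≤ s := by positivity
  have h1 : m * (x + t) / (2 * Real.pi) = m * x / (2 * Real.pi) + s := by
    rw [hs]; ring
  have h2 : ramp ε (m * x / (2 * Real.pi) + s) - ramp ε (m * x / (2 * Real.pi)) ≤
      s + min 1 (s / ε) := by
    have h3 := ramp_sub_le_add_one h.ratio_pos h.ratio_lt (m * x / (2 * Real.pi))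
      (m * x / (2 * Real.pi) + s)
    have h4 := ramp_sub_le_div h.ratio_pos h.ratio_lt
      (show m * x / (2 * Real.pi) ≤ m * x / (2 * Real.pi) + s by linarith)
    rw [add_sub_cancel_left, ← hε] at h3 h4
    rcases min_choice 1 (s / ε) with h5 | h5 <;> rw [h5] <;> linarith
  have h6 : s / ε = t / η := by
    rw [hs, hε]
    field_simp
  have h7 : 2 * Real.pi / m * s = t := by
    rw [hs]
    field_simp
  calc _ = 2 * Real.pi / m *
        (ramp ε (m * x / (2 * Real.pi) + s) - ramp ε (m * x / (2 * Real.pi))) := by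
        rw [comb, comb, h1, mul_sub]
    _ ≤ 2 * Real.pi / m * (s + min 1 (s / ε)) := by gcongr
    _ = _ := by rw [mul_add, h7, h6]

theorem comb_tooth (h : IsCombParam m η) (j : ℕ) :
    comb m η (2 * Real.pi * j / m + η) - comb m η (2 * Real.pi * j / m) = 2 * Real.pi / m := by
  have hm : (m : ℝ) ≠ 0 := by exact_mod_cast h.pos.ne'
  have h1 : m * (2 * Real.pi * j / m) / (2 * Real.pi) = (j : ℤ) := by
    push_cast
    field_simp
  have h2 : m * (2 * Real.pi * j / m + η) / (2 * Real.pi) = (j : ℤ) + m * η / (2 * Real.pi) := by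
    push_cast
    field_simp
  rw [comb, comb, h1, h2, ramp_intCast_add h.ratio_pos h.ratio_lt, ramp_intCast]
  ring

end IsCombParam

/-! ### The weighted series of combs -/

/-- The average of the identity and of `∑ 2^{-(k+1)} comb (m k) (η k)`. It is written as a perturbation
of the identity so that the series converges uniformly on the whole line. -/
noncomputable def combSeries (m : ℕ → ℕ) (η : ℕ → ℝ) (θ : ℝ) : ℝ :=
  θ + 2⁻¹ * ∑' k, (1 / 2) ^ (k + 1) * (comb (m k) (η k) θ - θ)

section combSeries

variable {m : ℕ → ℕ} {η : ℕ → ℝ}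

theorem hasSum_half_pow_succ : HasSum (fun k : ℕ => (1 / 2 : ℝ) ^ (k + 1)) 1 := by
  have := hasSum_geometric_two.mul_left (1 / 2 : ℝ)
  simp only [← pow_succ'] at this
  simpa using this

theorem abs_half_pow_mul_comb_sub_le (h : ∀ k, IsCombParam (m k) (η k)) (k : ℕ) (θ : ℝ) :
    ‖(1 / 2 : ℝ) ^ (k + 1) * (comb (m k) (η k) θ - θ)‖ ≤ (1 / 2) ^ (k + 1) * (2 * Real.pi) := by
  rw [norm_mul, Real.norm_of_nonneg (by positivity), Real.norm_eq_abs]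
  gcongr
  exact (h k).abs_comb_sub_self_le θ

theorem continuous_combSeries (h : ∀ k, IsCombParam (m k) (η k)) :
    Continuous (combSeries m η) := by
  refine continuous_id.add (continuous_const.mul (continuous_tsum
    (fun k => continuous_const.mul ((h k).continuous_comb.sub continuous_id))
    (hasSum_half_pow_succ.summable.mul_right (2 * Real.pi))
    fun k θ => abs_half_pow_mul_comb_sub_le h k θ))

theorem combSeries_zero : combSeries m η 0 = 0 := by
  simp [combSeries, IsCombParam.comb_zero]

/-- Increments of the series are averages of increments of the combs; the properties of `combSeries`
are read off from this. -/
theorem hasSum_comb_sub (h : ∀ k, IsCombParam (m k) (η k)) (x y : ℝ) :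
    HasSum (fun k => (1 / 2 : ℝ) ^ (k + 1) * (comb (m k) (η k) y - comb (m k) (η k) x))
      (2 * (combSeries m η y - combSeries m η x) - (y - x)) := by
  have hs : ∀ θ, HasSum (fun k => (1 / 2 : ℝ) ^ (k + 1) * (comb (m k) (η k) θ - θ))
      (2 * (combSeries m η θ - θ)) := fun θ => by
    have : Summable fun k => (1 / 2 : ℝ) ^ (k + 1) * (comb (m k) (η k) θ - θ) :=
      Summable.of_norm_bounded (hasSum_half_pow_succ.summable.mul_right (2 * Real.pi))
        fun k => abs_half_pow_mul_comb_sub_le h k θ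
    convert this.hasSum using 1
    rw [combSeries]
    ring
  convert! ((hs y).sub (hs x)).add (hasSum_half_pow_succ.mul_right (y - x)) using 1
  · ext k
    ring
  · ring

theorem half_sub_le_combSeries_sub (h : ∀ k, IsCombParam (m k) (η k)) {x y : ℝ} (hxy : x ≤ y) :
    (y - x) / 2 ≤ combSeries m η y - combSeries m η x := by
  have := (hasSum_comb_sub h x y).nonneg fun k => mul_nonneg (by positivity)
    (sub_nonneg.2 ((h k).monotone_comb hxy))
  linarith

theorem strictMono_combSeries (h : ∀ k, IsCombParam (m k) (η k)) :
    StrictMono (combSeries m η) := fun x y hxy => by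
  linarith [half_sub_le_combSeries_sub h hxy.le]

theorem combSeries_add_two_pi (h : ∀ k, IsCombParam (m k) (η k)) (x : ℝ) :
    combSeries m η (x + 2 * Real.pi) = combSeries m η x + 2 * Real.pi := by
  have h1 := hasSum_comb_sub h x (x + 2 * Real.pi)
  simp only [(h _).comb_add_two_pi, add_sub_cancel_left] at h1
  have := h1.unique (hasSum_half_pow_succ.mul_right (2 * Real.pi))
  linarith

theorem combSeries_tooth (h : ∀ k, IsCombParam (m k) (η k)) (k j : ℕ) :
    Real.pi * (1 / 2) ^ (k + 1) / m k ≤ combSeries m η (2 * Real.pi * j / m k + η k) -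
      combSeries m η (2 * Real.pi * j / m k) := by
  have hη := (h k).width_pos
  have h1 := le_hasSum (hasSum_comb_sub h (2 * Real.pi * j / m k) (2 * Real.pi * j / m k + η k)) k
    fun i _ => mul_nonneg (by positivity) (sub_nonneg.2 ((h i).monotone_comb (by linarith)))
  rw [(h k).comb_tooth] at h1
  have h2 : (1 / 2 : ℝ) ^ (k + 1) * (2 * Real.pi / m k) =
    2 * (Real.pi * (1 / 2) ^ (k + 1) / m k) := by ring
  linarith

end combSeries

/-! ### Choice of the parameters and conclusion -/

open Filter Topology in
/-- A tooth width `η` with `log (1/η) = m ^ r` and `1 < r < q` makes the `m`-tooth comb both cheap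
(`log (1/η)` is negligible against `m ^ q`) and effective (`log (1/η) / m` is large). -/
theorem exists_isCombParam {q : ℝ} (hq : 1 < q) {c : ℝ} (hc : 0 < c) (X : ℝ) :
    ∃ (m : ℕ) (η : ℝ), IsCombParam m η ∧ η ≤ 1 ∧
      (2 * Real.pi / m) ^ q * (1 + (Real.log Real.pi + Real.log η⁻¹)) ≤ c ∧
      X ≤ Real.log η⁻¹ / m := by
  set r := (1 + q) / 2 with hr
  have h1 : Tendsto (fun m : ℕ => (m : ℝ) ^ (r - 1)) atTop atTop :=
    (tendsto_rpow_atTop (by rw [hr]; linarith)).comp tendsto_natCast_atTop_atTop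
  have h2 : Tendsto (fun m : ℕ => (2 * Real.pi) ^ q * ((1 + Real.log Real.pi) * (m : ℝ) ^ (-q) +
      (m : ℝ) ^ (-(q - r)))) atTop (𝓝 ((2 * Real.pi) ^ q * ((1 + Real.log Real.pi) * 0 + 0))) :=
    ((((tendsto_rpow_neg_atTop (by linarith)).comp tendsto_natCast_atTop_atTop).const_mul _).add
      ((tendsto_rpow_neg_atTop (by rw [hr]; linarith)).comp
        tendsto_natCast_atTop_atTop)).const_mul _
  rw [mul_zero, add_zero, mul_zero] at h2
  obtain ⟨m, hX, hcm, hm⟩ := ((h1.eventually_ge_atTop X).and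
    ((h2.eventually_le_const hc).and (eventually_ge_atTop 1))).exists
  have hm1 : (1 : ℝ) ≤ m := by exact_mod_cast hm
  have hm0 : (0 : ℝ) < m := by linarith
  have hlog : Real.log (Real.exp (-(m : ℝ) ^ r))⁻¹ = (m : ℝ) ^ r := by
    rw [← Real.exp_neg, neg_neg, Real.log_exp]
  refine ⟨m, Real.exp (-(m : ℝ) ^ r), ⟨hm, Real.exp_pos _, ?_⟩, ?_, ?_, ?_⟩
  · have h3 : (m : ℝ) ≤ (m : ℝ) ^ r := Real.self_le_rpow_of_one_le hm1 (by rw [hr]; linarith)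
    have h4 : (m : ℝ) ≤ Real.exp ((m : ℝ) ^ r) := by
      linarith [Real.add_one_le_exp ((m : ℝ) ^ r)]
    calc (m : ℝ) * Real.exp (-(m : ℝ) ^ r) ≤
          Real.exp ((m : ℝ) ^ r) * Real.exp (-(m : ℝ) ^ r) := by gcongr
      _ = 1 := by rw [← Real.exp_add, add_neg_cancel, Real.exp_zero]
      _ < 2 * Real.pi := by linarith [Real.pi_gt_three]
  · exact Real.exp_le_one_iff.2 (by simpa using by positivity)
  · rw [hlog]
    refine le_trans (le_of_eq ?_) hcm
    rw [Real.div_rpow Real.two_pi_pos.le hm0.le, neg_sub, Real.rpow_sub hm0, Real.rpow_neg hm0.le]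
    field_simp
    ring
  · rw [hlog, ← Real.rpow_sub_one hm0.ne']
    exact hX

/-- The `dt / t`-integral of the `q`-th power of the modulus `A min(1, t/η)`: the range `t ≤ η`
contributes at most `A ^ q`, the range `η ≤ t ≤ π` exactly `A ^ q log (π/η)`. -/
theorem setLIntegral_tooth_modulus_le {q A η : ℝ} (hq : 1 ≤ q) (hA : 0 ≤ A) (h0 : 0 < η)
    (h1 : η ≤ 1) :
    ∫⁻ t in Ioc 0 Real.pi, ENNReal.ofReal (A * min 1 (t / η)) ^ q * (ENNReal.ofReal t)⁻¹ ≤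
      ENNReal.ofReal (A ^ q * (1 + (Real.log Real.pi + Real.log η⁻¹))) := by
  have hηπ : η ≤ Real.pi := h1.trans (by linarith [Real.pi_gt_three])
  have hpt : ∀ t, 0 < t → ENNReal.ofReal (A * min 1 (t / η)) ^ q * (ENNReal.ofReal t)⁻¹ =
      ENNReal.ofReal (A ^ q) * ENNReal.ofReal (min 1 (t / η) ^ q * t⁻¹) := fun t ht => by
    have hmin : 0 ≤ min 1 (t / η) := le_min zero_le_one (by positivity)
    rw [ENNReal.ofReal_rpow_of_nonneg (by positivity) (by linarith), ← ENNReal.ofReal_inv_of_pos ht,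
      ← ENNReal.ofReal_mul (by positivity), ← ENNReal.ofReal_mul (by positivity),
      Real.mul_rpow hA hmin, mul_assoc]
  rw [setLIntegral_congr_fun measurableSet_Ioc fun t ht => hpt t ht.1,
    lintegral_const_mul' _ _ ENNReal.ofReal_ne_top, ENNReal.ofReal_mul (by positivity)]
  refine mul_le_mul_right ?_ _
  rw [← Ioc_union_Ioc_eq_Ioc h0.le hηπ]
  refine (lintegral_union_le _ _ _).trans ?_
  have hlog : Real.log Real.pi + Real.log η⁻¹ = Real.log (Real.pi / η) := by
    rw [Real.log_inv, Real.log_div Real.pi_pos.ne' h0.ne', sub_eq_add_neg]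
  rw [hlog, ENNReal.ofReal_add zero_le_one (Real.log_nonneg ((one_le_div h0).2 hηπ))]
  refine add_le_add ?_ ?_
  · calc _ ≤ ∫⁻ t in Ioc 0 η, ENNReal.ofReal η⁻¹ := by
          refine setLIntegral_mono' measurableSet_Ioc fun t ht => ENNReal.ofReal_le_ofReal ?_
          have ht0 : 0 < t := ht.1
          have h2 : t / η ≤ 1 := (div_le_one h0).2 ht.2
          rw [min_eq_right h2]
          calc (t / η) ^ q * t⁻¹ ≤ (t / η) ^ (1 : ℝ) * t⁻¹ := by
                gcongr ?_ * _
                exact Real.rpow_le_rpow_of_exponent_ge (by positivity) h2 hq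
            _ = η⁻¹ := by rw [Real.rpow_one]; field_simp
      _ = ENNReal.ofReal 1 := by
          rw [setLIntegral_const, Real.volume_Ioc, sub_zero, ← ENNReal.ofReal_mul (by positivity),
            inv_mul_cancel₀ h0.ne']
  · rw [← integral_inv_of_pos h0 Real.pi_pos, intervalIntegral.integral_of_le hηπ,
      ofReal_integral_eq_lintegral_ofReal]
    · refine setLIntegral_mono' measurableSet_Ioc fun t ht => ENNReal.ofReal_le_ofReal ?_
      have ht0 : 0 < t := h0.trans ht.1
      rw [min_eq_left ((one_le_div h0).2 ht.1.le), Real.one_rpow, one_mul]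
    · refine ((continuousOn_inv₀ (G₀ := ℝ)).mono fun x hx => ?_).integrableOn_Icc.mono_set
        Ioc_subset_Icc_self
      exact (h0.trans_le hx.1).ne'
    · filter_upwards [ae_restrict_mem measurableSet_Ioc] with x hx
      exact inv_nonneg.2 (h0.le.trans hx.1.le)

/-- A modulus of continuity of `combSeries m η`. The `ℓ^q` norm of the moduli
`(2π/m_k) min(1, t/η_k)` of the individual combs dominates their weighted mean, and its `q`-th
power can be integrated termwise. -/
noncomputable def combModulus (q : ℝ) (m : ℕ → ℕ) (η : ℕ → ℝ) (t : ℝ) : ℝ≥0∞ :=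
  ENNReal.ofReal t +
    (∑' k, ENNReal.ofReal (2 * Real.pi / m k * min 1 (t / η k)) ^ q) ^ (1 / q)

theorem combSeries_add_sub_le {q : ℝ} (hq : 0 < q) {m : ℕ → ℕ} {η : ℕ → ℝ}
    (h : ∀ k, IsCombParam (m k) (η k)) (x t : ℝ) (ht : 0 < t) :
    ENNReal.ofReal (combSeries m η (x + t) - combSeries m η x) ≤ combModulus q m η t := by
  set S := (∑' k, ENNReal.ofReal (2 * Real.pi / m k * min 1 (t / η k)) ^ q) ^ (1 / q) with hS
  rw [combModulus, ← hS]
  rcases eq_or_ne S ⊤ with htop | htop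
  · rw [htop, add_top]
    exact le_top
  have hk : ∀ k, 2 * Real.pi / m k * min 1 (t / η k) ≤ S.toReal := fun k => by
    rw [← ENNReal.ofReal_le_iff_le_toReal htop, hS, one_div, ENNReal.le_rpow_inv_iff hq]
    exact ENNReal.le_tsum (f := fun k => ENNReal.ofReal (2 * Real.pi / m k * min 1 (t / η k)) ^ q) k
  have h1 := hasSum_le (fun k => ?_) (hasSum_comb_sub h x (x + t))
    (hasSum_half_pow_succ.mul_right (t + S.toReal))
  · rw [← ENNReal.ofReal_toReal htop, ← ENNReal.ofReal_add ht.le ENNReal.toReal_nonneg]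
    refine ENNReal.ofReal_le_ofReal ?_
    have := ENNReal.toReal_nonneg (a := S)
    linarith
  · refine mul_le_mul_of_nonneg_left ?_ (by positivity)
    linarith [(h k).comb_add_sub_le x ht.le, hk k]

theorem setLIntegral_combModulus_lt_top {q : ℝ} (hq : 1 < q) {m : ℕ → ℕ} {η : ℕ → ℝ}
    (h : ∀ k, IsCombParam (m k) (η k)) (h1 : ∀ k, η k ≤ 1)
    (hc : ∀ k, (2 * Real.pi / m k) ^ q * (1 + (Real.log Real.pi + Real.log (η k)⁻¹)) ≤
      (1 / 2) ^ k) :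
    ∫⁻ t in Ioc 0 Real.pi, combModulus q m η t ^ q * (ENNReal.ofReal t)⁻¹ < ⊤ := by
  set τ : ℕ → ℝ → ℝ≥0∞ := fun k t => ENNReal.ofReal (2 * Real.pi / m k * min 1 (t / η k)) ^ q
    with hτ
  have hτm : ∀ k, Measurable (τ k) := fun k => by
    simp only [hτ]
    fun_prop
  have hA : ∫⁻ t in Ioc 0 Real.pi, ENNReal.ofReal (t ^ (q - 1)) < ⊤ := by
    rw [setLIntegral_Ioc_rpow Real.pi_pos.le (by linarith)]
    exact ENNReal.ofReal_lt_top
  have hB : ∑' k, ∫⁻ t in Ioc 0 Real.pi, τ k t * (ENNReal.ofReal t)⁻¹ < ⊤ := by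
    refine (ENNReal.tsum_le_tsum fun k => (setLIntegral_tooth_modulus_le hq.le (by positivity)
      (h k).width_pos (h1 k)).trans (ENNReal.ofReal_le_ofReal (hc k))).trans_lt ?_
    rw [← ENNReal.ofReal_tsum_of_nonneg (fun k => by positivity) summable_geometric_two]
    exact ENNReal.ofReal_lt_top
  calc _ ≤ ∫⁻ t in Ioc 0 Real.pi, 2 ^ (q - 1) * (ENNReal.ofReal (t ^ (q - 1)) +
        ∑' k, τ k t * (ENNReal.ofReal t)⁻¹) := by
        refine setLIntegral_mono' measurableSet_Ioc fun t ht => ?_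
        have ht0 : 0 < t := ht.1
        have h2 : ENNReal.ofReal t ^ q * (ENNReal.ofReal t)⁻¹ = ENNReal.ofReal (t ^ (q - 1)) := by
          rw [← ENNReal.ofReal_inv_of_pos ht0, ENNReal.ofReal_rpow_of_pos ht0,
            ← ENNReal.ofReal_mul (by positivity), Real.rpow_sub_one ht0.ne', div_eq_mul_inv]
        calc _ ≤ 2 ^ (q - 1) * (ENNReal.ofReal t ^ q + ((∑' k, τ k t) ^ (1 / q)) ^ q) *
              (ENNReal.ofReal t)⁻¹ :=
              mul_le_mul_left (ENNReal.rpow_add_le_mul_rpow_add_rpow _ _ hq.le) _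
          _ = _ := by
              rw [← ENNReal.rpow_mul, one_div_mul_cancel (by linarith), ENNReal.rpow_one, mul_assoc,
                add_mul, h2, ENNReal.tsum_mul_right]
    _ = 2 ^ (q - 1) * ((∫⁻ t in Ioc 0 Real.pi, ENNReal.ofReal (t ^ (q - 1))) +
        ∑' k, ∫⁻ t in Ioc 0 Real.pi, τ k t * (ENNReal.ofReal t)⁻¹) := by
        have h2 : Measurable fun t => ∑' k, τ k t * (ENNReal.ofReal t)⁻¹ :=
          Measurable.tsum fun k => (hτm k).mul (by fun_prop)
        rw [lintegral_const_mul _ (by fun_prop), lintegral_add_left (by fun_prop), lintegral_tsum]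
        exact fun k => ((hτm k).mul (by fun_prop)).aemeasurable
    _ < ⊤ := ENNReal.mul_lt_top (ENNReal.rpow_lt_top_of_nonneg (by linarith) (by simp))
        (ENNReal.add_lt_top.2 ⟨hA, hB⟩)

/-- The `k`-th comb alone forces the inverse energy to be at least `k`: its teeth carry total mass
`w = π 2^{-(k+1)}`, and the potential there is at least `k/w + 1`. The extra `1` makes the
`(p - 1)`-th power of the potential at least the potential itself. -/
theorem le_inverseEnergy_combSeries {p : ℝ} (hp : 2 ≤ p) {m : ℕ → ℕ} {η : ℕ → ℝ}
    (h : ∀ k, IsCombParam (m k) (η k)) (k : ℕ) (h1 : η k ≤ 1)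
    {φ : Circle ≃ₜ Circle} (hφ : ∀ x, φ (Circle.exp x) = Circle.exp (combSeries m η x)) {w : ℝ}
    (hw : w = Real.pi * (1 / 2) ^ (k + 1))
    (hX : (k / w + 1 + 2 * Real.pi) / w ≤ Real.log (η k)⁻¹ / m k) :
    (k : ℝ≥0∞) ≤ inverseEnergy p (p - 2) 0 φ := by
  have hm : (0 : ℝ) < m k := by exact_mod_cast (h k).pos
  have hw0 : 0 < w := by rw [hw]; positivity
  have hV := le_inverseEnergy (p := p) (l := w / m k) (by linarith) (continuous_combSeries h)
    (strictMono_combSeries h).monotone (combSeries_add_two_pi h) combSeries_zero hφ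
    (m := m k) (a := fun j => 2 * Real.pi * j / m k) (b := fun j => 2 * Real.pi * j / m k + η k)
    (η := η k) (fun i j hij => by simp only; gcongr) (by simp) (by simp [hm.ne'])
    (fun j => by linarith [(h k).width_pos])
    (fun j => by
      have := (h k).width_lt
      push_cast
      rw [mul_add, add_div, mul_one]
      gcongr
      rw [le_div_iff₀ hm]
      linarith)
    (fun j => by simp) (h k).width_pos h1 (fun j => hw ▸ combSeries_tooth h k j)
  refine le_trans ?_ hV
  have hN : k / w + 1 ≤ Real.log (η k)⁻¹ * (w / m k) - 2 * Real.pi := by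
    rw [div_le_iff₀ hw0] at hX
    have : Real.log (η k)⁻¹ / m k * w = Real.log (η k)⁻¹ * (w / m k) := by ring
    linarith
  have hkw : 0 ≤ k / w := by positivity
  have hmw : (m k : ℝ≥0∞) * ENNReal.ofReal (w / m k) = ENNReal.ofReal w := by
    rw [← ENNReal.ofReal_natCast, ← ENNReal.ofReal_mul hm.le, mul_div_cancel₀ _ hm.ne']
  calc (k : ℝ≥0∞) = ENNReal.ofReal w * ENNReal.ofReal (k / w) := by
        rw [← ENNReal.ofReal_mul hw0.le, mul_div_cancel₀ _ hw0.ne', ENNReal.ofReal_natCast]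
    _ ≤ ENNReal.ofReal w *
        ENNReal.ofReal (Real.log (η k)⁻¹ * (w / m k) - 2 * Real.pi) ^ (p - 1) := by
        gcongr
        set N := Real.log (η k)⁻¹ * (w / m k) - 2 * Real.pi
        calc ENNReal.ofReal (k / w) ≤ ENNReal.ofReal N := ENNReal.ofReal_le_ofReal (by linarith)
          _ = ENNReal.ofReal N ^ (1 : ℝ) := (ENNReal.rpow_one _).symm
          _ ≤ ENNReal.ofReal N ^ (p - 1) := by
              refine ENNReal.rpow_le_rpow_of_exponent_le ?_ (by linarith)
              exact ENNReal.one_le_ofReal.2 (by linarith)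
    _ = _ := by rw [hmw]

theorem exists_homeomorph_inverseEnergy_eq_top {p : ℝ} (hp : 2 < p) :
    ∃ φ : Circle ≃ₜ Circle, inverseEnergy p (p - 2) 0 φ = ⊤ ∧
      ∫⁻ z in Metric.ball (0 : ℂ) 1, ENNReal.ofReal
        (‖fderiv ℝ (poissonExtension φ) z‖ ^ p * (1 - ‖z‖) ^ (p - 2)) < ⊤ := by
  have hq : 1 < p - 1 := by linarith
  choose m η h h1 hc hX using fun k : ℕ => exists_isCombParam hq
    (show (0 : ℝ) < (1 / 2) ^ k by positivity)
    ((k / (Real.pi * (1 / 2) ^ (k + 1)) + 1 + 2 * Real.pi) / (Real.pi * (1 / 2) ^ (k + 1)))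
  obtain ⟨φ, hφ⟩ := exists_circleHomeomorph_of_lift (continuous_combSeries h)
    (strictMono_combSeries h) (combSeries_add_two_pi h)
  refine ⟨φ, ENNReal.eq_top_of_forall_nnreal_le fun r => ?_, ?_⟩
  · obtain ⟨k, hk⟩ := exists_nat_ge r
    exact le_trans (by exact_mod_cast hk)
      (le_inverseEnergy_combSeries hp.le h k (h1 k) hφ rfl (hX k))
  · exact lintegral_fderiv_poissonExtension_lt_top hp (continuous_combSeries h)
      (strictMono_combSeries h).monotone (combSeries_add_two_pi h) hφ
      (combSeries_add_sub_le (by linarith) h) (setLIntegral_combModulus_lt_top hq h h1 hc)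

end CircleExtension

theorem mainTheorem6 (p : ℝ) (hp : 2 < p) :
    (∃ φ : Circle ≃ₜ Circle,
      CircleExtension.inverseEnergy p (p - 2) 0 φ = ⊤ ∧
      CircleExtension.energyOne p (p - 2) 0 (CircleExtension.poissonExtension φ) < ⊤ ∧
      CircleExtension.energyTwo p (p - 2) 0 (CircleExtension.poissonExtension φ) < ⊤) ∧
    (¬ ∃ C : NNReal, ∀ φ : Circle ≃ₜ Circle,
      CircleExtension.inverseEnergy p (p - 2) 0 φ ≤
        (C : ENNReal) *
          (1 + CircleExtension.energyOne p (p - 2) 0 (CircleExtension.poissonExtension φ))) ∧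
    (¬ ∃ C : NNReal, ∀ φ : Circle ≃ₜ Circle,
      CircleExtension.inverseEnergy p (p - 2) 0 φ ≤
        (C : ENNReal) *
          (1 + CircleExtension.energyTwo p (p - 2) 0 (CircleExtension.poissonExtension φ))) := by
  obtain ⟨φ, hV, hE⟩ := CircleExtension.exists_homeomorph_inverseEnergy_eq_top hp
  have h1 : CircleExtension.energyOne p (p - 2) 0 (CircleExtension.poissonExtension φ) < ⊤ := by
    simpa only [CircleExtension.energyOne, Real.rpow_zero, mul_one] using hE
  have h2 : CircleExtension.energyTwo p (p - 2) 0 (CircleExtension.poissonExtension φ) < ⊤ := by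
    simpa only [CircleExtension.energyTwo, Real.rpow_zero, mul_one] using hE
  refine ⟨⟨φ, hV, h1, h2⟩, ?_, ?_⟩
  · rintro ⟨C, hC⟩
    exact ((hC φ).trans_lt (ENNReal.mul_lt_top ENNReal.coe_lt_top
      (ENNReal.add_lt_top.2 ⟨ENNReal.one_lt_top, h1⟩))).ne hV
  · rintro ⟨C, hC⟩
    exact ((hC φ).trans_lt (ENNReal.mul_lt_top ENNReal.coe_lt_top
      (ENNReal.add_lt_top.2 ⟨ENNReal.one_lt_top, h2⟩))).ne hV
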